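/- Let $C>\frac{4}{3^{3/2}}$ and $0<C^\ast<\left(C-\frac{4}{3^{3/2}}\right)^{-1/2}$. Put $T(\xi)=-\xi^{8/3}+3C\xi^2-3$ for $\xi>0$. Then $T$ has exactly two positive zeros $\xi_{01}<\xi_{02}$, and $\xi_{00}:=\left(\frac94C\right)^{3/2}\in(\xi_{01},\xi_{02})$. For $\xi\in(\xi_{01},\xi_{02})$ put $$\zeta_0(\xi)=\int_{\xi_{00}}^{\xi}\frac{\sqrt C\,\tau^{4/3}}{(-1+C\tau^2)\sqrt{T(\tau)}}\,d\tau,\qquad h_0(\xi)=\int_{\xi_{00}}^{\xi}\sqrt{\frac{3\tau^2-(C^\ast)^2T(\tau)}{\tau^4T(\tau)}}\,d\tau .$$ Both functions have finite limits at the ends of the interval, denoted $\zeta_{0,-1},h_{0,-1}$ (as $\xi\searrow\xi_{01}$) and $\zeta_{0,1},h_{0,1}$ (as $\xi\nearrow\xi_{02}$), and are extended continuously to $[\xi_{01},\xi_{02}]$ by these values; moreover $h_{0,-1}<h_{0,1}$. Put $L=h_{0,1}-h_{0,-1}$ and, for $k\in\mathbb Z$, $I_k=[h_{0,-1}+kL,\;h_{0,1}+kL]$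 and $$h_k(\xi)=\begin{cases}kL+h_0(\xi), & k \text{ even},\\ (k+1)h_{0,1}-(k-1)h_{0,-1}-h_0(\xi), & k\text{ odd}.\end{cases}$$ Each $h_k$ is a bijection of $[\xi_{01},\xi_{02}]$ onto $I_k$, and there is a unique function $F:\mathbb R\to[\xi_{01},\xi_{02}]$ with $F(h_k(\xi))=\xi$ for all $k\in\mathbb Z$ and $\xi\in[\xi_{01},\xi_{02}]$. It is of class $C^3$ and periodic with period $2L$, and $$g_{C,C^\ast}(h,\theta)=\frac{3F^2(h)}{3F^2(h)-(C^\ast)^2\,T(F(h))}\,dh^2+\frac{1}{F^2(h)}\,d\theta^2$$ is a complete Riemannian metric of class $C^3$ on $\mathbb R^2$. Let $(c_k)_{k\in\mathbb Z}$ be real numbers ($c_0$ arbitrary) such that, modulo $2\pi$, $$c_k\equiv\begin{cases}k(\zeta_{0,1}-\zeta_{0,-1})+c_0, & k\text{ even},\\ (k-1)\zeta_{0,-1}-(k+1)\zeta_{0,1}-c_0, & k\text{ odd}.\end{cases}$$ For $h\in I_k$ define $$\Phi^1(h)=\sqrt{1-\tfrac{1}{CF(h)^2}}\,\cos\big(\zeta_0(F(h))+c_k\big),\qquad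 \Phi^2(h)=(-1)^k\sqrt{1-\tfrac{1}{CF(h)^2}}\,\sin\big(\zeta_0(F(h))+c_k\big)$$ (the definitions agree at the common endpoints of the $I_k$), and for $h\in\mathbb R$ let $\Phi^3(h)=\Phi^4(h)=\frac{1}{\sqrt C\,F(h)}$. Then $$\Phi_{C,C^\ast}(h,\theta)=\left(\Phi^1(h),\ \Phi^2(h),\ \Phi^3(h)\cos(\sqrt C\,\theta),\ \Phi^4(h)\sin(\sqrt C\,\theta)\right)$$ is a map of class $C^3$ from $\mathbb R^2$ to the unit sphere $\mathbb S^3\subset\mathbb R^4$; for $h\in I_k$ it equals $\Phi_C(F(h),\theta)$, where $$\Phi_C(\xi,\theta)=\left(\sqrt{1-\tfrac{1}{C\xi^2}}\cos\zeta,\ \sqrt{1-\tfrac{1}{C\xi^2}}\sin\zeta,\ \tfrac{\cos(\sqrt C\theta)}{\sqrt C\xi},\ \tfrac{\sin(\sqrt C\theta)}{\sqrt C\xi}\right),\qquad \zeta=(-1)^k(\zeta_0(\xi)+c_k).$$ It is an isometric immersion of $(\mathbb R^2,g_{C,C^\ast})$ into $\mathbb S^3$, and it is biconservative, i.e. $\operatorname{Div}S_2=0$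 on $\mathbb R^2$, where $$S_2(X,Y)=\tfrac12|\tau|^2\langle X,Y\rangle+\langle d\Phi,\nabla\tau\rangle\langle X,Y\rangle-\langle d\Phi(X),\nabla_Y\tau\rangle-\langle d\Phi(Y),\nabla_X\tau\rangle,$$ $\Phi=\Phi_{C,C^\ast}$ and $\tau=\operatorname{trace}\nabla d\Phi$ is its tension field. -/

import Mathlib

open Set Filter Topology

namespace Biconservative

noncomputable section

/-! ### Riemannian geometry of the coordinate plane -/

/-- The ambient Euclidean space `ℝ⁴`. -/
abbrev E4 : Type := EuclideanSpace ℝ (Fin 4)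

/-- The coordinate vectors of the plane. -/
def basisVec : Fin 2 → ℝ × ℝ := ![(1, 0), (0, 1)]

/-- The `i`-th partial derivative of a function on the plane. -/
def pd {V : Type*} [NormedAddCommGroup V] [NormedSpace ℝ V]
    (i : Fin 2) (f : ℝ × ℝ → V) (p : ℝ × ℝ) : V :=
  fderiv ℝ f p (basisVec i)

/-- The coefficients `g_{ij}` of a (not necessarily definite) metric on the plane. -/
abbrev PlaneMetric : Type := ℝ × ℝ → Matrix (Fin 2) (Fin 2) ℝ

/-- `G` is a Riemannian metric of class `C³` on the plane. -/
def IsRiemannianMetric (G : PlaneMetric) : Prop :=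
  (∀ i j, ContDiff ℝ 3 (fun p => G p i j)) ∧ ∀ p, (G p).PosDef

/-- The value `g_p(v, v)` of the metric. -/
def quadForm (G : PlaneMetric) (p v : ℝ × ℝ) : ℝ :=
  ∑ i, ∑ j, G p i j * ![v.1, v.2] i * ![v.1, v.2] j

/-- The Riemannian distance of `G`: the infimum of the `G`-lengths of `C¹` paths. -/
def riemDist (G : PlaneMetric) (p q : ℝ × ℝ) : ENNReal :=
  letI : ∀ x : ℝ × ℝ, ENorm (TangentSpace (modelWithCornersSelf ℝ (ℝ × ℝ)) x) :=
    fun x => ⟨fun v => ENNReal.ofReal (√(quadForm G x v))⟩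
  Manifold.riemannianEDist (modelWithCornersSelf ℝ (ℝ × ℝ)) p q

/-- Completeness of the plane for the Riemannian distance of `G`:
every Cauchy sequence converges. -/
def IsCompleteMetric (G : PlaneMetric) : Prop :=
  ∀ u : ℕ → ℝ × ℝ,
    (∀ ε : ENNReal, 0 < ε → ∃ N, ∀ m ≥ N, ∀ n ≥ N, riemDist G (u m) (u n) < ε) →
    ∃ a, Tendsto (fun n => riemDist G (u n) a) atTop (𝓝 0)

/-- The Christoffel symbols `Γ^k_{ij}` of the Levi-Civita connection. -/
def christoffel (G : PlaneMetric) (k i j : Fin 2) (p : ℝ × ℝ) : ℝ :=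
  (1 / 2) * ∑ l, (G p)⁻¹ k l *
    (pd i (fun q => G q j l) p + pd j (fun q => G q i l) p - pd l (fun q => G q i j) p)

/-- `φ` is a Riemannian (isometric) immersion of the plane with the metric `G` into the unit
sphere `𝕊³` of `ℝ⁴`. -/
def IsRiemannianImmersion (G : PlaneMetric) (φ : ℝ × ℝ → E4) : Prop :=
  Differentiable ℝ φ ∧ (∀ p, φ p ∈ Metric.sphere (0 : E4) 1) ∧
    (∀ p, Function.Injective (fderiv ℝ φ p)) ∧
    ∀ p i j, inner ℝ (pd i φ p) (pd j φ p) = G p i j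

/-- The connection `∇^φ` of the pull-back bundle `φ⁻¹ T𝕊³`: the covariant derivative of the
section `V` along `φ` in the direction `∂_i` is the orthogonal projection of the derivative of
`V` in `ℝ⁴` to the tangent space `φ(p)^⊥` of the unit sphere. -/
def covD (φ : ℝ × ℝ → E4) (i : Fin 2) (V : ℝ × ℝ → E4) (p : ℝ × ℝ) : E4 :=
  pd i V p - (inner ℝ (φ p) (pd i V p) : ℝ) • φ p

/-- The tension field `τ(φ) = trace ∇dφ` of a map into the unit sphere. -/
def tension (G : PlaneMetric) (φ : ℝ × ℝ → E4) (p : ℝ × ℝ) : E4 :=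
  ∑ i, ∑ j, (G p)⁻¹ i j •
    (covD φ i (pd j φ) p - ∑ k, christoffel G k i j p • pd k φ p)

/-- The components `S₂(∂_i, ∂_j)` of the stress-bienergy tensor
`S₂(X,Y) = ½|τ|²⟨X,Y⟩ + ⟨dφ,∇τ⟩⟨X,Y⟩ - ⟨dφ(X),∇_Y τ⟩ - ⟨dφ(Y),∇_X τ⟩`. -/
def stressBienergy (G : PlaneMetric) (φ : ℝ × ℝ → E4) (i j : Fin 2) (p : ℝ × ℝ) : ℝ :=
  (1 / 2) * ‖tension G φ p‖ ^ 2 * G p i j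
    + (∑ k, ∑ l, (G p)⁻¹ k l * inner ℝ (pd k φ p) (covD φ l (tension G φ) p)) * G p i j
    - inner ℝ (pd i φ p) (covD φ j (tension G φ) p)
    - inner ℝ (pd j φ p) (covD φ i (tension G φ) p)

/-- The components of `Div S₂`, i.e. `g^{ik} (∇_k S₂)_{ij}`. -/
def divStressBienergy (G : PlaneMetric) (φ : ℝ × ℝ → E4) (j : Fin 2) (p : ℝ × ℝ) : ℝ :=
  ∑ i, ∑ k, (G p)⁻¹ i k *
    (pd k (stressBienergy G φ i j) p
      - ∑ l, christoffel G l k i p * stressBienergy G φ l j p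
      - ∑ l, christoffel G l k j p * stressBienergy G φ i l p)

/-- `φ` is biconservative: `τ(φ)` and `S₂` are differentiable (so that `S₂` and `Div S₂` make
sense classically) and `Div S₂ = 0` on the whole plane. -/
def IsBiconservative (G : PlaneMetric) (φ : ℝ × ℝ → E4) : Prop :=
  Differentiable ℝ (tension G φ) ∧
    (∀ i j, Differentiable ℝ (stressBienergy G φ i j)) ∧
    ∀ j p, divStressBienergy G φ j p = 0

/-! ### The explicit construction -/

/-- `T(ξ) = -ξ^{8/3} + 3Cξ² - 3`. -/
def T (C ξ : ℝ) : ℝ := -ξ ^ (8 / 3 : ℝ) + 3 * C * ξ ^ 2 - 3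

/-- `ξ₀₁`, the smallest positive zero of `T`. -/
def xi01 (C : ℝ) : ℝ := sInf {ξ | 0 < ξ ∧ T C ξ = 0}

/-- `ξ₀₂`, the largest positive zero of `T`. -/
def xi02 (C : ℝ) : ℝ := sSup {ξ | 0 < ξ ∧ T C ξ = 0}

/-- The base point `ξ₀₀ = (9C/4)^{3/2}` of the integrals. -/
def xi00 (C : ℝ) : ℝ := (9 / 4 * C) ^ (3 / 2 : ℝ)

/-- The phase function `ζ₀`, including its (improper integral) values at `ξ₀₁` and `ξ₀₂`. -/
def zeta0 (C ξ : ℝ) : ℝ :=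
  ∫ τ in (xi00 C)..ξ, √C * τ ^ (4 / 3 : ℝ) / ((-1 + C * τ ^ 2) * √(T C τ))

/-- `ζ_{0,-1}`, the limit value of `ζ₀` at `ξ₀₁`. -/
def zetaNeg (C : ℝ) : ℝ := zeta0 C (xi01 C)

/-- `ζ_{0,1}`, the limit value of `ζ₀` at `ξ₀₂`. -/
def zetaPos (C : ℝ) : ℝ := zeta0 C (xi02 C)

/-- The height function `h₀` of the profile curve, including its (improper integral) values at
`ξ₀₁` and `ξ₀₂`. Here `Cs` stands for `C*`. -/
def h0 (C Cs ξ : ℝ) : ℝ :=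
  ∫ τ in (xi00 C)..ξ, √((3 * τ ^ 2 - Cs ^ 2 * T C τ) / (τ ^ 4 * T C τ))

/-- `h_{0,-1}`, the limit value of `h₀` at `ξ₀₁`. -/
def hNeg (C Cs : ℝ) : ℝ := h0 C Cs (xi01 C)

/-- `h_{0,1}`, the limit value of `h₀` at `ξ₀₂`. -/
def hPos (C Cs : ℝ) : ℝ := h0 C Cs (xi02 C)

/-- The reflected height functions `h_k`, `k ∈ ℤ`. -/
def hk (C Cs : ℝ) (k : ℤ) (ξ : ℝ) : ℝ :=
  if Even k then k * (hPos C Cs - hNeg C Cs) + h0 C Cs ξ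
  else (k + 1) * hPos C Cs - (k - 1) * hNeg C Cs - h0 C Cs ξ

/-- The closed interval of heights covered by `h_k`. With `h_{0,k} = k h_{0,1} - (k-1) h_{0,-1}`
for `k ≥ 1` and `h_{0,k} = -k h_{0,-1} + (k+1) h_{0,1}` for `k ≤ -1`, this is
`[h_{0,k}, h_{0,k+1}]` for `k ≥ 1`, `[h_{0,-1}, h_{0,1}]` for `k = 0` and
`[h_{0,k-1}, h_{0,k}]` for `k ≤ -1`. -/
def piece (C Cs : ℝ) (k : ℤ) : Set ℝ :=
  Icc (hNeg C Cs + k * (hPos C Cs - hNeg C Cs)) (hPos C Cs + k * (hPos C Cs - hNeg C Cs))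

/-- An index `k` of a piece containing `h` (at a common endpoint of two pieces, the upper one). -/
def pieceIndex (C Cs h : ℝ) : ℤ := ⌊(h - hNeg C Cs) / (hPos C Cs - hNeg C Cs)⌋

/-- The function `F`, equal on the `k`-th piece to the inverse of `h_k`. -/
def F (C Cs h : ℝ) : ℝ :=
  Function.invFunOn (hk C Cs (pieceIndex C Cs h)) (Icc (xi01 C) (xi02 C)) h

/-- The metric `g_{C,C*}` on the plane. -/
def gMetric (C Cs : ℝ) : PlaneMetric := fun p =>
  !![3 * F C Cs p.1 ^ 2 / (3 * F C Cs p.1 ^ 2 - Cs ^ 2 * T C (F C Cs p.1)), 0;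
     0, 1 / F C Cs p.1 ^ 2]

/-- The conditions on the phase constants `c_k`, with `c_0` arbitrary. -/
def IsPhaseSequence (C : ℝ) (c : ℤ → ℝ) : Prop :=
  ∀ k : ℤ,
    (Even k → c k ≡ k * (zetaPos C - zetaNeg C) + c 0 [PMOD (2 * Real.pi)]) ∧
    (Odd k → c k ≡ (k - 1) * zetaNeg C - (k + 1) * zetaPos C - c 0 [PMOD (2 * Real.pi)])

/-- `Φ¹_k` on `[ξ₀₁, ξ₀₂]`. -/
def Phi1k (C : ℝ) (c : ℤ → ℝ) (k : ℤ) (ξ : ℝ) : ℝ :=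
  √(1 - 1 / (C * ξ ^ 2)) * Real.cos (zeta0 C ξ + c k)

/-- `Φ²_k` on `[ξ₀₁, ξ₀₂]`. -/
def Phi2k (C : ℝ) (c : ℤ → ℝ) (k : ℤ) (ξ : ℝ) : ℝ :=
  (-1) ^ k * √(1 - 1 / (C * ξ ^ 2)) * Real.sin (zeta0 C ξ + c k)

/-- `Φ¹`, equal to `Φ¹_k ∘ F` on the `k`-th piece. -/
def Phi1 (C Cs : ℝ) (c : ℤ → ℝ) (h : ℝ) : ℝ := Phi1k C c (pieceIndex C Cs h) (F C Cs h)

/-- `Φ²`, equal to `Φ²_k ∘ F` on the `k`-th piece. -/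
def Phi2 (C Cs : ℝ) (c : ℤ → ℝ) (h : ℝ) : ℝ := Phi2k C c (pieceIndex C Cs h) (F C Cs h)

/-- `Φ³ = 1 / (√C F)`. -/
def Phi3 (C Cs h : ℝ) : ℝ := 1 / (√C * F C Cs h)

/-- `Φ⁴ = 1 / (√C F)`. -/
def Phi4 (C Cs h : ℝ) : ℝ := 1 / (√C * F C Cs h)

/-- The map `Φ_{C,C*}`, as a map to `ℝ⁴`. -/
def PhiMap (C Cs : ℝ) (c : ℤ → ℝ) (p : ℝ × ℝ) : E4 :=
  !₂[Phi1 C Cs c p.1, Phi2 C Cs c p.1,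
     Phi3 C Cs p.1 * Real.cos (√C * p.2), Phi4 C Cs p.1 * Real.sin (√C * p.2)]

/-- The local parametrization `Φ_C` with the phase `ζ = ε (ζ₀ + c)`, where `ε = ±1`. -/
def PhiLocal (C ε c ξ θ : ℝ) : E4 :=
  !₂[√(1 - 1 / (C * ξ ^ 2)) * Real.cos (ε * (zeta0 C ξ + c)),
     √(1 - 1 / (C * ξ ^ 2)) * Real.sin (ε * (zeta0 C ξ + c)),
     Real.cos (√C * θ) / (√C * ξ), Real.sin (√C * θ) / (√C * ξ)]

/-- The data of the construction make sense: `T` has exactly the two positive zeros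
`ξ₀₁ < ξ₀₀ < ξ₀₂`, the improper integrals defining `ζ_{0,±1}` and `h_{0,±1}` converge to these
values, and each `h_k` is a bijection of `[ξ₀₁, ξ₀₂]` onto the `k`-th piece. -/
structure IsWellDefined (C Cs : ℝ) : Prop where
  zeros : ∀ ξ, 0 < ξ → (T C ξ = 0 ↔ ξ = xi01 C ∨ ξ = xi02 C)
  pos : 0 < xi01 C
  lt_base : xi01 C < xi00 C
  base_lt : xi00 C < xi02 C
  tendsto_zetaNeg : Tendsto (zeta0 C) (𝓝[>] (xi01 C)) (𝓝 (zetaNeg C))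
  tendsto_zetaPos : Tendsto (zeta0 C) (𝓝[<] (xi02 C)) (𝓝 (zetaPos C))
  tendsto_hNeg : Tendsto (h0 C Cs) (𝓝[>] (xi01 C)) (𝓝 (hNeg C Cs))
  tendsto_hPos : Tendsto (h0 C Cs) (𝓝[<] (xi02 C)) (𝓝 (hPos C Cs))
  hNeg_lt_hPos : hNeg C Cs < hPos C Cs
  bijOn : ∀ k : ℤ, BijOn (hk C Cs k) (Icc (xi01 C) (xi02 C)) (piece C Cs k)

end

end Biconservative

open Biconservative

/-!
The variable `y = ξ ^ (2 / 3)` turns `T` into the quartic `-y⁴ + 3Cy³ - 3`, which factors as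
`(y - a)(b - y)(y² + αy + β)` with `0 < a < 9C/4 < b` and `α, β > 0` (`exists_quartic_factor`);
the bound on `C*` is the positivity of `3ξ² - C*² T` (`quartic_lower_bound`).

The whole construction becomes smooth in an angle `t` with `y = (a + b)/2 - (b - a)/2 cos t`.
Under this substitution `√T` becomes `(b - a)/2 |sin t| √(y² + αy + β)`, and the factor `sin t`
cancels against `dy/dt`. Hence the singular integrals `h₀` and `ζ₀` become integrals `H` and `Z` of
smooth, even, `2π`-periodic functions of `t` (`h0_xi`, `zeta0_xi`). Evenness and periodicity
make the reflected pieces `h_k` restrictions of the single function `H` to the intervals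
`[kπ, (k + 1)π]` (`hk_xi`), and the conditions on the `c_k` say that the phases of the
pieces are, modulo `2π` and up to orientation, restrictions of `Z` (`exists_phase_eq`). Since
`H' > 0`, `H` is a diffeomorphism of `ℝ`, and `F` is `ξ` as a function of `t = H⁻¹`
(`F_eq`), so that no regularity has to be checked at the junctions.

The metric is diagonal with periodic positive coefficients, hence pinched between multiples of the
flat metric, hence complete (`isCompleteMetric_of_pinched`).

For biconservativity an explicit unit normal `N` is used, whose derivatives show that the
coordinate directions are principal with curvatures `-f/2` and `3f/2`, where `f = 2 F^(4/3) / (3√3)`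
(`isPrincipalFrame`). The Gauss formula gives `τ = f N`, so `S₂` has the eigenvalues
`-3f²/2` and `5f²/2`, and its divergence vanishes exactly when `f³ Q²` is constant, `Q = 1 / F²`
being the coefficient of `dθ²` (`IsPrincipalFrame.isBiconservative`, `meanCurv_ode`).
-/

namespace Biconservative

noncomputable section

/-! ### Primitives of even periodic functions -/

section EvenPeriodic

variable {w : ℝ → ℝ}

lemma integral_neg_of_even (heven : ∀ t, w (-t) = w t) (t : ℝ) :
    ∫ x in (0 : ℝ)..(-t), w x = -∫ x in (0 : ℝ)..t, w x := by
  have h := intervalIntegral.integral_comp_neg (a := (0 : ℝ)) (b := t) w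
  simp only [heven, neg_zero] at h
  rw [h, intervalIntegral.integral_symm]

lemma integral_add_two_pi (hw : Continuous w) (hper : ∀ t, w (t + 2 * Real.pi) = w t) (t : ℝ) :
    ∫ x in (0 : ℝ)..(t + 2 * Real.pi), w x
      = (∫ x in (0 : ℝ)..t, w x) + ∫ x in (0 : ℝ)..(2 * Real.pi), w x := by
  have hp : Function.Periodic w (2 * Real.pi) := hper
  have h := hp.intervalIntegral_add_eq t 0
  rw [zero_add] at h
  rw [← h, intervalIntegral.integral_add_adjacent_intervals] <;>
    exact hw.intervalIntegrable _ _

/-- Over a full period, an even periodic function integrates to twice its integral over half a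
period. -/
lemma integral_two_pi_of_even (hw : Continuous w) (heven : ∀ t, w (-t) = w t)
    (hper : ∀ t, w (t + 2 * Real.pi) = w t) :
    ∫ x in (0 : ℝ)..(2 * Real.pi), w x = 2 * ∫ x in (0 : ℝ)..Real.pi, w x := by
  have h := integral_add_two_pi hw hper (-Real.pi)
  rw [integral_neg_of_even heven, show -Real.pi + 2 * Real.pi = Real.pi by ring] at h
  linarith

lemma integral_add_even_mul_pi (hw : Continuous w) (heven : ∀ t, w (-t) = w t)
    (hper : ∀ t, w (t + 2 * Real.pi) = w t) (m : ℤ) (t : ℝ) :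
    ∫ x in (0 : ℝ)..(t + 2 * m * Real.pi), w x
      = (∫ x in (0 : ℝ)..t, w x) + 2 * m * ∫ x in (0 : ℝ)..Real.pi, w x := by
  induction m using Int.induction_on with
  | zero => simp
  | succ i ih =>
    have h := integral_add_two_pi hw hper (t + 2 * (i : ℤ) * Real.pi)
    rw [integral_two_pi_of_even hw heven hper, ih] at h
    rw [show t + 2 * ((i + 1 : ℤ) : ℝ) * Real.pi = t + 2 * (i : ℤ) * Real.pi + 2 * Real.pi by
      push_cast; ring, h]
    push_cast; ring
  | pred i ih =>
    have h := integral_add_two_pi hw hper (t + 2 * ((-i - 1 : ℤ) : ℝ) * Real.pi)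
    rw [integral_two_pi_of_even hw heven hper,
      show t + 2 * ((-i - 1 : ℤ) : ℝ) * Real.pi + 2 * Real.pi = t + 2 * ((-i : ℤ) : ℝ) * Real.pi by
        push_cast; ring, ih] at h
    push_cast at h ⊢
    linarith

end EvenPeriodic

/-! ### The angular parametrisation of the profile -/

/-- The data of the profile curve in the variable `y = ξ ^ (2 / 3)`: the polynomial
`-y⁴ + 3Cy³ - 3` (the value of `T`) has the two positive roots `a < 9C/4 < b` and a
quadratic cofactor with positive coefficients, and the radicand `3y³ - C*² T` is positive. -/
structure Profile where
  C : ℝ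
  Cs : ℝ
  a : ℝ
  b : ℝ
  α : ℝ
  β : ℝ
  a_pos : 0 < a
  a_lt_base : a < 9 / 4 * C
  base_lt_b : 9 / 4 * C < b
  α_pos : 0 < α
  β_pos : 0 < β
  factor : ∀ y, -y ^ 4 + 3 * C * y ^ 3 - 3 = (y - a) * (b - y) * (y ^ 2 + α * y + β)
  radicand_pos : ∀ y, 0 < y → 0 < 3 * y ^ 3 - Cs ^ 2 * (-y ^ 4 + 3 * C * y ^ 3 - 3)

lemma three_rpow_three_halves : (3 : ℝ) ^ (3 / 2 : ℝ) = 3 * √3 := by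
  rw [show (3 / 2 : ℝ) = 1 + 1 / 2 by norm_num, Real.rpow_add (by norm_num), Real.rpow_one,
    ← Real.sqrt_eq_rpow]

/-- Factorisation of the quartic `-y⁴ + 3Cy³ - 3` once it is positive at its maximum. -/
lemma exists_quartic_factor {C : ℝ} (hC0 : 0 < C) (hC : 256 < 729 * C ^ 4) :
    ∃ a b α β : ℝ, 0 < a ∧ a < 9 / 4 * C ∧ 9 / 4 * C < b ∧ 0 < α ∧ 0 < β ∧
      ∀ y, -y ^ 4 + 3 * C * y ^ 3 - 3 = (y - a) * (b - y) * (y ^ 2 + α * y + β) := by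
  set p : ℝ → ℝ := fun y => -y ^ 4 + 3 * C * y ^ 3 - 3 with hp
  have hcont : Continuous p := by fun_prop
  have hmid : 0 < p (9 / 4 * C) := by simp only [hp]; nlinarith
  have h0 : p 0 < 0 := by simp [hp]
  have h3 : p (3 * C) < 0 := by simp only [hp]; nlinarith
  obtain ⟨a, ⟨ha0, ha1⟩, hpa⟩ := intermediate_value_Ioo (by positivity : (0 : ℝ) ≤ 9 / 4 * C)
    hcont.continuousOn (show (0 : ℝ) ∈ Ioo _ _ from ⟨h0, hmid⟩)
  obtain ⟨b, ⟨hb0, hb1⟩, hpb⟩ := intermediate_value_Ioo' (by linarith : 9 / 4 * C ≤ 3 * C)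
    hcont.continuousOn (show (0 : ℝ) ∈ Ioo _ _ from ⟨h3, hmid⟩)
  have hab : a < b := ha1.trans hb0
  have hb : 0 < b := ha0.trans hab
  have hm : 0 < a * b := mul_pos ha0 hb
  simp only [hp] at hpa hpb
  set β := 3 / (a * b) with hβ
  have hβm : β * (a * b) = 3 := by rw [hβ]; field_simp
  have hβ0 : 0 < β := by positivity
  set α := a + b - 3 * C with hα
  -- the remaining two coefficients define a linear function of `y` vanishing at `a` and `b`
  have ea : (β - (a + b) * α + a * b) * a + (a * b * α - (a + b) * β) = 0 := by
    have : a * ((β - (a + b) * α + a * b) * a + (a * b * α - (a + b) * β)) = 0 := by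
      rw [hα]; linear_combination hpa - hβm
    rcases mul_eq_zero.1 this with h | h
    · exact absurd h ha0.ne'
    · exact h
  have eb : (β - (a + b) * α + a * b) * b + (a * b * α - (a + b) * β) = 0 := by
    have : b * ((β - (a + b) * α + a * b) * b + (a * b * α - (a + b) * β)) = 0 := by
      rw [hα]; linear_combination hpb - hβm
    rcases mul_eq_zero.1 this with h | h
    · exact absurd h hb.ne'
    · exact h
  have e2 : β - (a + b) * α + a * b = 0 := by
    have : (β - (a + b) * α + a * b) * (b - a) = 0 := by linear_combination eb - ea
    rcases mul_eq_zero.1 this with h | h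
    · exact h
    · exact absurd h (sub_pos.2 hab).ne'
  have e1 : a * b * α - (a + b) * β = 0 := by rw [e2] at ea; linarith
  refine ⟨a, b, α, β, ha0, ha1, hb0, ?_, hβ0, fun y => ?_⟩
  · have : 0 < a * b * α := by
      have : 0 < (a + b) * β := by positivity
      linarith
    exact (pos_iff_pos_of_mul_pos this).1 hm
  · have e3 : 3 * C = a + b - α := by rw [hα]; ring
    rw [e3]
    linear_combination y ^ 2 * e2 + y * e1 + hβm

/-- `y⁴ + 3 ≥ (4 / √3) y³`, the tangent line inequality behind the bound on `C*`. -/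
lemma quartic_lower_bound (y : ℝ) (hy : 0 < y) : 4 * √3 / 3 * y ^ 3 ≤ y ^ 4 + 3 := by
  have h3 : √3 ^ 2 = 3 := Real.sq_sqrt (by norm_num)
  have hs : 0 < √3 := by positivity
  have key : y ^ 4 + 3 - 4 * √3 / 3 * y ^ 3
      = (y - √3) ^ 2 * (y ^ 2 + 2 * √3 / 3 * y + 1) := by
    linear_combination (y ^ 2 / 3 - 2 / 3 * y * √3 - 1) * h3
  have : 0 ≤ (y - √3) ^ 2 * (y ^ 2 + 2 * √3 / 3 * y + 1) := by positivity
  linarith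

lemma exists_profile {C Cs : ℝ} (hC : 4 / (3 : ℝ) ^ (3 / 2 : ℝ) < C) (hCs_pos : 0 < Cs)
    (hCs_lt : Cs < (C - 4 / (3 : ℝ) ^ (3 / 2 : ℝ)) ^ (-(1 / 2) : ℝ)) :
    ∃ P : Profile, P.C = C ∧ P.Cs = Cs := by
  have h3 : √3 ^ 2 = 3 := Real.sq_sqrt (by norm_num)
  have hs : 0 < √3 := by positivity
  have hk : 4 / (3 : ℝ) ^ (3 / 2 : ℝ) = 4 * √3 / 9 := by
    rw [three_rpow_three_halves]; field_simp; linear_combination -3 * h3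
  rw [hk] at hC hCs_lt
  have hC0 : 0 < C := lt_trans (by positivity) hC
  have hX : 0 < C - 4 * √3 / 9 := sub_pos.2 hC
  have hC4 : 256 < 729 * C ^ 4 := by
    have : (4 * √3 / 9) ^ 4 < C ^ 4 := by gcongr
    have e : (4 * √3 / 9) ^ 4 = 256 / 729 := by
      rw [show (4 * √3 / 9) ^ 4 = 256 / 6561 * (√3 ^ 2) ^ 2 by ring, h3]; norm_num
    rw [e] at this; linarith
  have hCs2 : Cs ^ 2 * (C - 4 * √3 / 9) < 1 := by
    have h1 : Cs ^ 2 < ((C - 4 * √3 / 9) ^ (-(1 / 2) : ℝ)) ^ 2 := by gcongr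
    rw [← Real.rpow_natCast (_ ^ (_ : ℝ)), ← Real.rpow_mul hX.le,
      show (-(1 / 2) : ℝ) * ((2 : ℕ) : ℝ) = -1 by norm_num, Real.rpow_neg_one] at h1
    calc _ < (C - 4 * √3 / 9)⁻¹ * (C - 4 * √3 / 9) := by gcongr
      _ = 1 := inv_mul_cancel₀ hX.ne'
  obtain ⟨a, b, α, β, h1, h2, h3', h4, h5, h6⟩ := exists_quartic_factor hC0 hC4
  refine ⟨⟨C, Cs, a, b, α, β, h1, h2, h3', h4, h5, h6, fun y hy => ?_⟩, rfl, rfl⟩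
  have hq := quartic_lower_bound y hy
  have hy3 : 0 < y ^ 3 := by positivity
  have e1 : Cs ^ 2 * (-y ^ 4 + 3 * C * y ^ 3 - 3)
      ≤ Cs ^ 2 * (3 * (C - 4 * √3 / 9) * y ^ 3) := by
    gcongr; linarith
  have e2 : Cs ^ 2 * (C - 4 * √3 / 9) * (3 * y ^ 3) < 1 * (3 * y ^ 3) := by gcongr
  linarith

namespace Profile

variable (P : Profile)

lemma C_pos : 0 < P.C := by linarith [P.a_pos, P.a_lt_base]
lemma a_lt_b : P.a < P.b := P.a_lt_base.trans P.base_lt_b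

/-- The variable `y = ξ ^ (2 / 3)` as a function of the angle `t`. -/
def y (t : ℝ) : ℝ := (P.a + P.b) / 2 - (P.b - P.a) / 2 * Real.cos t

/-- `u = ξ ^ (1 / 3)` as a function of the angle `t`. -/
def u (t : ℝ) : ℝ := √(P.y t)

/-- `ξ` as a function of the angle `t`; the interval `[ξ₀₁, ξ₀₂]` corresponds to `[0, π]`. -/
def xi (t : ℝ) : ℝ := P.u t ^ 3

/-- The quadratic cofactor of `T`. -/
def quo (t : ℝ) : ℝ := P.y t ^ 2 + P.α * P.y t + P.β

/-- A square root of `T` that is a smooth function of the angle: `T = σ²`. -/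
def sig (t : ℝ) : ℝ := (P.b - P.a) / 2 * Real.sin t * √(P.quo t)

/-- The radicand `3ξ² - C*² T`. -/
def rad (t : ℝ) : ℝ :=
  3 * P.y t ^ 3 - P.Cs ^ 2 * (-P.y t ^ 4 + 3 * P.C * P.y t ^ 3 - 3)

/-- The derivative of the height with respect to the angle. -/
def hSpeed (t : ℝ) : ℝ := 3 / 2 * √(P.rad t) / (P.u t ^ 5 * √(P.quo t))

/-- The derivative of the phase with respect to the angle. -/
def zSpeed (t : ℝ) : ℝ := 3 / 2 * √P.C * P.u t ^ 5 / ((P.C * P.u t ^ 6 - 1) * √(P.quo t))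

/-- The height as a function of the angle, normalised to vanish at `t = 0`. -/
def H (t : ℝ) : ℝ := ∫ s in (0 : ℝ)..t, P.hSpeed s

/-- The phase as a function of the angle, normalised to vanish at `t = 0`. -/
def Z (t : ℝ) : ℝ := ∫ s in (0 : ℝ)..t, P.zSpeed s

lemma a_le_y (t : ℝ) : P.a ≤ P.y t := by
  unfold y; nlinarith [P.a_lt_b, Real.cos_le_one t]

lemma y_le_b (t : ℝ) : P.y t ≤ P.b := by
  unfold y; nlinarith [P.a_lt_b, Real.neg_one_le_cos t]

lemma y_pos (t : ℝ) : 0 < P.y t := P.a_pos.trans_le (P.a_le_y t)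
lemma u_pos (t : ℝ) : 0 < P.u t := Real.sqrt_pos.2 (P.y_pos t)
lemma u_sq (t : ℝ) : P.u t ^ 2 = P.y t := Real.sq_sqrt (P.y_pos t).le
lemma xi_pos (t : ℝ) : 0 < P.xi t := pow_pos (P.u_pos t) 3

lemma quo_pos (t : ℝ) : 0 < P.quo t := by
  have := P.y_pos t; have := P.α_pos; have := P.β_pos
  unfold quo; positivity

lemma rad_pos (t : ℝ) : 0 < P.rad t := P.radicand_pos _ (P.y_pos t)

lemma sig_sq (t : ℝ) : P.sig t ^ 2 = -P.y t ^ 4 + 3 * P.C * P.y t ^ 3 - 3 := by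
  rw [P.factor]
  unfold sig
  rw [mul_pow, mul_pow, Real.sq_sqrt (P.quo_pos t).le, Real.sin_sq]
  unfold quo
  simp only [y]
  ring

lemma sig_sq' (t : ℝ) : P.sig t ^ 2 = -P.u t ^ 8 + 3 * P.C * P.u t ^ 6 - 3 := by
  rw [P.sig_sq, ← P.u_sq]; ring

lemma rad_eq (t : ℝ) : P.rad t = 3 * P.u t ^ 6 - P.Cs ^ 2 * P.sig t ^ 2 := by
  rw [P.sig_sq, rad, ← P.u_sq]; ring

lemma one_lt (t : ℝ) : 0 < P.C * P.u t ^ 6 - 1 := by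
  have h := P.sig_sq' t
  have := P.u_pos t
  have : 0 < P.u t ^ 8 := by positivity
  nlinarith [sq_nonneg (P.sig t)]

lemma contDiff_y {n : WithTop ℕ∞} : ContDiff ℝ n P.y := by unfold y; fun_prop

lemma contDiff_u {n : WithTop ℕ∞} : ContDiff ℝ n P.u :=
  P.contDiff_y.sqrt fun t => (P.y_pos t).ne'

lemma contDiff_quo {n : WithTop ℕ∞} : ContDiff ℝ n P.quo := by
  have := P.contDiff_y (n := n); unfold quo; fun_prop

lemma contDiff_sqrt_quo {n : WithTop ℕ∞} : ContDiff ℝ n fun t => √(P.quo t) :=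
  P.contDiff_quo.sqrt fun t => (P.quo_pos t).ne'

lemma contDiff_sig {n : WithTop ℕ∞} : ContDiff ℝ n P.sig := by
  have := P.contDiff_sqrt_quo (n := n); unfold sig; fun_prop

lemma contDiff_rad {n : WithTop ℕ∞} : ContDiff ℝ n P.rad := by
  have := P.contDiff_y (n := n); unfold rad; fun_prop

lemma contDiff_hSpeed {n : WithTop ℕ∞} : ContDiff ℝ n P.hSpeed := by
  have h1 := P.contDiff_sqrt_quo (n := n)
  have h2 : ContDiff ℝ n fun t => √(P.rad t) := P.contDiff_rad.sqrt fun t => (P.rad_pos t).ne'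
  have h3 := P.contDiff_u (n := n)
  unfold hSpeed
  refine ContDiff.div (by fun_prop) (by fun_prop) fun t => ?_
  have := P.u_pos t; have := P.quo_pos t; positivity

lemma contDiff_zSpeed {n : WithTop ℕ∞} : ContDiff ℝ n P.zSpeed := by
  have h1 := P.contDiff_sqrt_quo (n := n)
  have h3 := P.contDiff_u (n := n)
  unfold zSpeed
  refine ContDiff.div (by fun_prop) (by fun_prop) fun t => ?_
  have := P.one_lt t; have := P.quo_pos t; positivity

lemma hSpeed_pos (t : ℝ) : 0 < P.hSpeed t := by
  have := P.u_pos t; have := P.quo_pos t; have := P.rad_pos t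
  unfold hSpeed; positivity

lemma y_neg (t : ℝ) : P.y (-t) = P.y t := by simp [y]
lemma y_add_two_pi (t : ℝ) : P.y (t + 2 * Real.pi) = P.y t := by simp [y]
lemma u_neg (t : ℝ) : P.u (-t) = P.u t := by simp [u, y_neg]
lemma u_add_two_pi (t : ℝ) : P.u (t + 2 * Real.pi) = P.u t := by simp [u, y_add_two_pi]
lemma xi_neg (t : ℝ) : P.xi (-t) = P.xi t := by simp [xi, u_neg]
lemma xi_add_two_pi (t : ℝ) : P.xi (t + 2 * Real.pi) = P.xi t := by simp [xi, u_add_two_pi]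
lemma hSpeed_neg (t : ℝ) : P.hSpeed (-t) = P.hSpeed t := by
  simp [hSpeed, rad, quo, u_neg, y_neg]
lemma hSpeed_add_two_pi (t : ℝ) : P.hSpeed (t + 2 * Real.pi) = P.hSpeed t := by
  simp [hSpeed, rad, quo, u_add_two_pi, y_add_two_pi]
lemma zSpeed_neg (t : ℝ) : P.zSpeed (-t) = P.zSpeed t := by
  simp [zSpeed, quo, u_neg, y_neg]
lemma zSpeed_add_two_pi (t : ℝ) : P.zSpeed (t + 2 * Real.pi) = P.zSpeed t := by
  simp [zSpeed, quo, u_add_two_pi, y_add_two_pi]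

lemma xi_even_mul_pi (m : ℤ) (t : ℝ) : P.xi (t + 2 * m * Real.pi) = P.xi t := by
  have h := Function.Periodic.int_mul (f := P.xi) (c := 2 * Real.pi) P.xi_add_two_pi m t
  rw [← h]; congr 1; ring

lemma hasDerivAt_H (t : ℝ) : HasDerivAt P.H (P.hSpeed t) t := by
  have hc : Continuous P.hSpeed := (P.contDiff_hSpeed (n := 0)).continuous
  exact intervalIntegral.integral_hasDerivAt_right (hc.intervalIntegrable _ _)
    hc.aestronglyMeasurable.stronglyMeasurableAtFilter hc.continuousAt

lemma hasDerivAt_Z (t : ℝ) : HasDerivAt P.Z (P.zSpeed t) t := by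
  have hc : Continuous P.zSpeed := (P.contDiff_zSpeed (n := 0)).continuous
  exact intervalIntegral.integral_hasDerivAt_right (hc.intervalIntegrable _ _)
    hc.aestronglyMeasurable.stronglyMeasurableAtFilter hc.continuousAt

lemma contDiff_H : ContDiff ℝ 4 P.H := by
  rw [show (4 : WithTop ℕ∞) = 3 + 1 by norm_num, contDiff_succ_iff_deriv]
  refine ⟨fun t => (P.hasDerivAt_H t).differentiableAt, by simp, ?_⟩
  rw [show deriv P.H = P.hSpeed from funext fun t => (P.hasDerivAt_H t).deriv]
  exact P.contDiff_hSpeed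

lemma contDiff_Z : ContDiff ℝ 4 P.Z := by
  rw [show (4 : WithTop ℕ∞) = 3 + 1 by norm_num, contDiff_succ_iff_deriv]
  refine ⟨fun t => (P.hasDerivAt_Z t).differentiableAt, by simp, ?_⟩
  rw [show deriv P.Z = P.zSpeed from funext fun t => (P.hasDerivAt_Z t).deriv]
  exact P.contDiff_zSpeed

lemma strictMono_H : StrictMono P.H :=
  strictMono_of_deriv_pos fun t => by rw [(P.hasDerivAt_H t).deriv]; exact P.hSpeed_pos t

lemma H_zero : P.H 0 = 0 := by simp [H]
lemma Z_zero : P.Z 0 = 0 := by simp [Z]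

lemma H_even_mul_pi (m : ℤ) (t : ℝ) :
    P.H (t + 2 * m * Real.pi) = P.H t + 2 * m * P.H Real.pi :=
  integral_add_even_mul_pi (P.contDiff_hSpeed (n := 0)).continuous P.hSpeed_neg
    P.hSpeed_add_two_pi m t

lemma Z_even_mul_pi (m : ℤ) (t : ℝ) :
    P.Z (t + 2 * m * Real.pi) = P.Z t + 2 * m * P.Z Real.pi :=
  integral_add_even_mul_pi (P.contDiff_zSpeed (n := 0)).continuous P.zSpeed_neg
    P.zSpeed_add_two_pi m t

lemma H_neg (t : ℝ) : P.H (-t) = -P.H t := integral_neg_of_even P.hSpeed_neg t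
lemma Z_neg (t : ℝ) : P.Z (-t) = -P.Z t := integral_neg_of_even P.zSpeed_neg t

lemma H_pi_pos : 0 < P.H Real.pi := by
  rw [← P.H_zero]; exact P.strictMono_H Real.pi_pos

lemma surjective_H : Function.Surjective P.H := by
  have hc : Continuous P.H := P.contDiff_H.continuous
  intro x
  obtain ⟨n, hn⟩ := exists_nat_gt (|x| / P.H Real.pi)
  have hn' : |x| < n * P.H Real.pi := (div_lt_iff₀ P.H_pi_pos).1 hn
  have e1 : P.H (0 + 2 * (n : ℤ) * Real.pi) = 2 * n * P.H Real.pi := by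
    rw [P.H_even_mul_pi, P.H_zero]; simp
  have e2 : P.H (-(0 + 2 * (n : ℤ) * Real.pi)) = -(2 * n * P.H Real.pi) := by rw [P.H_neg, e1]
  have hx := abs_lt.1 hn'
  have h0 := abs_nonneg x
  exact mem_range_of_exists_le_of_exists_ge hc
    ⟨-(0 + 2 * (n : ℤ) * Real.pi), by rw [e2]; linarith⟩
    ⟨0 + 2 * (n : ℤ) * Real.pi, by rw [e1]; linarith⟩

/-- The height, as a homeomorphism from angles to heights. -/
def heightHomeomorph : ℝ ≃ₜ ℝ := (P.strictMono_H.orderIsoOfSurjective _ P.surjective_H).toHomeomorph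

lemma H_symm_apply (x : ℝ) : P.H (P.heightHomeomorph.symm x) = x :=
  P.heightHomeomorph.apply_symm_apply x

lemma contDiff_heightHomeomorph_symm : ContDiff ℝ 4 P.heightHomeomorph.symm :=
  P.heightHomeomorph.contDiff_symm_deriv (f' := P.hSpeed) (fun t => (P.hSpeed_pos t).ne')
    P.hasDerivAt_H P.contDiff_H

/-! ### The zeros of `T` and the angular substitution in the integrals -/

lemma rpow_pow_three {u : ℝ} (hu : 0 ≤ u) (p : ℝ) : (u ^ 3) ^ p = u ^ (3 * p) := by
  rw [← Real.rpow_natCast u 3, ← Real.rpow_mul hu]; norm_num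

lemma T_pow_three {u : ℝ} (hu : 0 ≤ u) (C : ℝ) : T C (u ^ 3) = -u ^ 8 + 3 * C * u ^ 6 - 3 := by
  rw [T, rpow_pow_three hu, show (3 : ℝ) * (8 / 3) = (8 : ℕ) by norm_num, Real.rpow_natCast]
  ring

lemma T_xi (t : ℝ) : T P.C (P.xi t) = P.sig t ^ 2 := by
  rw [xi, T_pow_three (P.u_pos t).le, P.sig_sq']

lemma exists_pow_three_eq {ξ : ℝ} (hξ : 0 < ξ) : ∃ v, 0 < v ∧ v ^ 3 = ξ :=
  ⟨ξ ^ (1 / 3 : ℝ), by positivity, by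
    rw [← Real.rpow_natCast, ← Real.rpow_mul hξ.le]; norm_num⟩

lemma y_zero : P.y 0 = P.a := by simp [y]; ring
lemma y_pi : P.y Real.pi = P.b := by simp [y]; ring

lemma T_eq_zero_iff {ξ : ℝ} (hξ : 0 < ξ) :
    T P.C ξ = 0 ↔ ξ = P.xi 0 ∨ ξ = P.xi Real.pi := by
  obtain ⟨v, hv, rfl⟩ := exists_pow_three_eq hξ
  have hval : T P.C (v ^ 3) = (v ^ 2 - P.a) * (P.b - v ^ 2) *
      ((v ^ 2) ^ 2 + P.α * v ^ 2 + P.β) := by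
    rw [T_pow_three hv.le, ← P.factor]; ring
  have hq : (v ^ 2) ^ 2 + P.α * v ^ 2 + P.β ≠ 0 := by
    have := P.α_pos; have := P.β_pos; positivity
  have key : ∀ t, v ^ 3 = P.xi t ↔ v ^ 2 = P.y t := fun t => by
    rw [xi, ← P.u_sq, pow_left_inj₀ hv.le (P.u_pos t).le (by norm_num),
      pow_left_inj₀ hv.le (P.u_pos t).le (by norm_num)]
  rw [hval, key, key, P.y_zero, P.y_pi, mul_eq_zero, mul_eq_zero, or_iff_left hq, sub_eq_zero,
    sub_eq_zero, eq_comm (a := P.b)]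

lemma u_lt_u_of_y_lt_y {s t : ℝ} (h : P.y s < P.y t) : P.u s < P.u t :=
  Real.sqrt_lt_sqrt (P.y_pos s).le h

lemma xi_lt_xi_of_y_lt_y {s t : ℝ} (h : P.y s < P.y t) : P.xi s < P.xi t :=
  pow_lt_pow_left₀ (P.u_lt_u_of_y_lt_y h) (P.u_pos s).le (by norm_num)

lemma strictMonoOn_xi : StrictMonoOn P.xi (Icc 0 Real.pi) := fun s hs t ht hst => by
  refine P.xi_lt_xi_of_y_lt_y ?_
  have h1 := Real.strictAntiOn_cos hs ht hst
  have h2 := P.a_lt_b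
  unfold y
  nlinarith

lemma setOf_zeros : {ξ | 0 < ξ ∧ T P.C ξ = 0} = {P.xi 0, P.xi Real.pi} := by
  ext ξ
  simp only [mem_ofPred_eq, mem_insert_iff, mem_singleton_iff]
  constructor
  · rintro ⟨h1, h2⟩
    exact (P.T_eq_zero_iff h1).1 h2
  · intro h
    have h1 : 0 < ξ := by rcases h with rfl | rfl <;> exact P.xi_pos _
    exact ⟨h1, (P.T_eq_zero_iff h1).2 h⟩

lemma xi_zero_lt_xi_pi : P.xi 0 < P.xi Real.pi :=
  P.strictMonoOn_xi ⟨le_rfl, Real.pi_pos.le⟩ ⟨Real.pi_pos.le, le_rfl⟩ Real.pi_pos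

lemma xi01_eq : xi01 P.C = P.xi 0 := by
  rw [xi01, setOf_zeros, csInf_pair, min_eq_left P.xi_zero_lt_xi_pi.le]

lemma xi02_eq : xi02 P.C = P.xi Real.pi := by
  rw [xi02, setOf_zeros, csSup_pair, max_eq_right P.xi_zero_lt_xi_pi.le]

/-- The inverse of `xi` on `[0, π]`. -/
def angle (ξ : ℝ) : ℝ :=
  Real.arccos (((P.a + P.b) / 2 - ξ ^ (2 / 3 : ℝ)) / ((P.b - P.a) / 2))

lemma continuous_angle : Continuous P.angle := by
  unfold angle
  have h : Continuous fun ξ : ℝ => ξ ^ (2 / 3 : ℝ) := Real.continuous_rpow_const (by norm_num)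
  fun_prop

lemma angle_mem (ξ : ℝ) : P.angle ξ ∈ Icc 0 Real.pi :=
  ⟨Real.arccos_nonneg _, Real.arccos_le_pi _⟩

lemma xi_rpow (t : ℝ) : P.xi t ^ (2 / 3 : ℝ) = P.y t := by
  rw [xi, rpow_pow_three (P.u_pos t).le, show (3 : ℝ) * (2 / 3) = (2 : ℕ) by norm_num,
    Real.rpow_natCast, P.u_sq]

lemma y_angle {v : ℝ} (hv : v ∈ Icc P.a P.b) :
    P.y (Real.arccos (((P.a + P.b) / 2 - v) / ((P.b - P.a) / 2))) = v := by
  have hd : 0 < (P.b - P.a) / 2 := by linarith [P.a_lt_b]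
  rw [y, Real.cos_arccos, mul_div_cancel₀ _ hd.ne']
  · ring
  · rw [le_div_iff₀ hd]; linarith [hv.2]
  · rw [div_le_iff₀ hd]; linarith [hv.1]

lemma xi_angle {ξ : ℝ} (hξ : ξ ∈ Icc (P.xi 0) (P.xi Real.pi)) : P.xi (P.angle ξ) = ξ := by
  have h0 : 0 < ξ := (P.xi_pos 0).trans_le hξ.1
  have hy : P.y (P.angle ξ) = ξ ^ (2 / 3 : ℝ) := by
    refine P.y_angle ⟨?_, ?_⟩
    · rw [← P.y_zero, ← P.xi_rpow]
      exact Real.rpow_le_rpow (P.xi_pos 0).le hξ.1 (by norm_num)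
    · rw [← P.y_pi, ← P.xi_rpow]
      exact Real.rpow_le_rpow h0.le hξ.2 (by norm_num)
  rw [xi, u, hy, Real.sqrt_eq_rpow, ← Real.rpow_mul h0.le, ← Real.rpow_natCast,
    ← Real.rpow_mul h0.le]
  norm_num

lemma bijOn_xi : BijOn P.xi (Icc 0 Real.pi) (Icc (P.xi 0) (P.xi Real.pi)) := by
  refine ⟨fun t ht => ⟨?_, ?_⟩, P.strictMonoOn_xi.injOn,
    fun ξ hξ => ⟨P.angle ξ, P.angle_mem ξ, P.xi_angle hξ⟩⟩
  · exact P.strictMonoOn_xi.monotoneOn ⟨le_rfl, Real.pi_pos.le⟩ ht ht.1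
  · exact P.strictMonoOn_xi.monotoneOn ht ⟨Real.pi_pos.le, le_rfl⟩ ht.2

/-- The angle of the base point `ξ₀₀`. -/
def baseAngle : ℝ := Real.arccos (((P.a + P.b) / 2 - 9 / 4 * P.C) / ((P.b - P.a) / 2))

lemma y_baseAngle : P.y P.baseAngle = 9 / 4 * P.C :=
  P.y_angle ⟨P.a_lt_base.le, P.base_lt_b.le⟩

lemma baseAngle_mem : P.baseAngle ∈ Icc 0 Real.pi :=
  ⟨Real.arccos_nonneg _, Real.arccos_le_pi _⟩

lemma xi00_eq : xi00 P.C = P.xi P.baseAngle := by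
  have h : 0 ≤ 9 / 4 * P.C := by linarith [P.C_pos]
  rw [xi00, xi, u, y_baseAngle, Real.sqrt_eq_rpow, ← Real.rpow_natCast, ← Real.rpow_mul h]
  norm_num

lemma hasDerivAt_y (t : ℝ) : HasDerivAt P.y ((P.b - P.a) / 2 * Real.sin t) t := by
  have h := ((Real.hasDerivAt_cos t).const_mul ((P.b - P.a) / 2)).const_sub ((P.a + P.b) / 2)
  convert! h using 1; ring

lemma hasDerivAt_u (t : ℝ) :
    HasDerivAt P.u ((P.b - P.a) / 2 * Real.sin t / (2 * P.u t)) t :=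
  (P.hasDerivAt_y t).sqrt (P.y_pos t).ne'

lemma hasDerivAt_xi (t : ℝ) :
    HasDerivAt P.xi (3 / 2 * P.u t * ((P.b - P.a) / 2 * Real.sin t)) t := by
  have hu := (P.u_pos t).ne'
  convert! (P.hasDerivAt_u t).pow 3 using 1
  field_simp
  norm_num
  ring

lemma integral_xi_of_le {f w : ℝ → ℝ}
    (hfw : ∀ t ∈ Ioo 0 Real.pi,
      3 / 2 * P.u t * ((P.b - P.a) / 2 * Real.sin t) * f (P.xi t) = w t)
    {s t : ℝ} (hs : 0 ≤ s) (hst : s ≤ t) (ht : t ≤ Real.pi) :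
    ∫ x in (P.xi s)..(P.xi t), f x = ∫ x in s..t, w x := by
  have hsub : Icc s t ⊆ Icc 0 Real.pi := Icc_subset_Icc hs ht
  have hmono : StrictMonoOn P.xi (Icc s t) := P.strictMonoOn_xi.mono hsub
  have hcont : ContinuousOn P.xi (Icc s t) := fun x _ =>
    (P.hasDerivAt_xi x).continuousAt.continuousWithinAt
  have hle : P.xi s ≤ P.xi t :=
    hmono.monotoneOn ⟨le_rfl, hst⟩ ⟨hst, le_rfl⟩ hst
  have himg : P.xi '' Icc s t = Icc (P.xi s) (P.xi t) :=
    hcont.image_Icc_of_monotoneOn hst hmono.monotoneOn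
  rw [intervalIntegral.integral_of_le hle, intervalIntegral.integral_of_le hst,
    ← MeasureTheory.integral_Icc_eq_integral_Ioc, ← himg,
    MeasureTheory.integral_image_eq_integral_abs_deriv_smul measurableSet_Icc
      (fun x _ => (P.hasDerivAt_xi x).hasDerivWithinAt) hmono.injOn,
    MeasureTheory.integral_Icc_eq_integral_Ioc, MeasureTheory.integral_Ioc_eq_integral_Ioo,
    MeasureTheory.integral_Ioc_eq_integral_Ioo]
  refine MeasureTheory.setIntegral_congr_fun measurableSet_Ioo fun x hx => ?_
  have hx' : x ∈ Ioo 0 Real.pi := ⟨hs.trans_lt hx.1, hx.2.trans_le ht⟩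
  have h1 : 0 < Real.sin x := Real.sin_pos_of_mem_Ioo hx'
  have h2 := P.a_lt_b
  have h3 := P.u_pos x
  have : 0 ≤ 3 / 2 * P.u x * ((P.b - P.a) / 2 * Real.sin x) := by
    have : 0 < P.b - P.a := by linarith
    positivity
  simp only [abs_of_nonneg this, smul_eq_mul]
  exact hfw x hx'

/-- Substitution of the angle in an integral over `[ξ₀₁, ξ₀₂]`; the endpoints, where the
integrand `f` may be singular, are allowed. -/
lemma integral_xi {f w : ℝ → ℝ}
    (hfw : ∀ t ∈ Ioo 0 Real.pi,
      3 / 2 * P.u t * ((P.b - P.a) / 2 * Real.sin t) * f (P.xi t) = w t)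
    {s t : ℝ} (hs : s ∈ Icc 0 Real.pi) (ht : t ∈ Icc 0 Real.pi) :
    ∫ x in (P.xi s)..(P.xi t), f x = ∫ x in s..t, w x := by
  rcases le_total s t with h | h
  · exact P.integral_xi_of_le hfw hs.1 h ht.2
  · rw [intervalIntegral.integral_symm, P.integral_xi_of_le hfw ht.1 h hs.2,
      ← intervalIntegral.integral_symm]

lemma sig_pos {t : ℝ} (ht : t ∈ Ioo 0 Real.pi) : 0 < P.sig t := by
  have h1 : 0 < Real.sin t := Real.sin_pos_of_mem_Ioo ht
  have h2 : 0 < P.b - P.a := by linarith [P.a_lt_b]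
  have h3 := P.quo_pos t
  unfold sig; positivity

lemma h0_xi {t : ℝ} (ht : t ∈ Icc 0 Real.pi) :
    h0 P.C P.Cs (P.xi t) = P.H t - P.H P.baseAngle := by
  have hc : Continuous P.hSpeed := (P.contDiff_hSpeed (n := 0)).continuous
  rw [h0, xi00_eq, P.integral_xi (w := P.hSpeed) ?_ P.baseAngle_mem ht, H, H,
    intervalIntegral.integral_interval_sub_left (hc.intervalIntegrable _ _)
      (hc.intervalIntegrable _ _)]
  intro s hs
  have hσ := P.sig_pos hs
  have hu := P.u_pos s
  have hq := P.quo_pos s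
  have hr := P.rad_pos s
  have hsin : 0 < Real.sin s := Real.sin_pos_of_mem_Ioo hs
  have hd : 0 < P.b - P.a := by linarith [P.a_lt_b]
  have e1 : 3 * P.xi s ^ 2 - P.Cs ^ 2 * P.sig s ^ 2 = P.rad s := by rw [rad_eq, xi]; ring
  have e2 : P.xi s ^ 4 * P.sig s ^ 2 = (P.u s ^ 6 * P.sig s) ^ 2 := by rw [xi]; ring
  rw [P.T_xi, e1, e2, Real.sqrt_div hr.le, Real.sqrt_sq (by positivity), hSpeed, sig]
  field_simp

lemma zeta0_xi {t : ℝ} (ht : t ∈ Icc 0 Real.pi) :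
    zeta0 P.C (P.xi t) = P.Z t - P.Z P.baseAngle := by
  have hc : Continuous P.zSpeed := (P.contDiff_zSpeed (n := 0)).continuous
  rw [zeta0, xi00_eq, P.integral_xi (w := P.zSpeed) ?_ P.baseAngle_mem ht, Z, Z,
    intervalIntegral.integral_interval_sub_left (hc.intervalIntegrable _ _)
      (hc.intervalIntegrable _ _)]
  intro s hs
  have hσ := P.sig_pos hs
  have hu := P.u_pos s
  have hq := P.quo_pos s
  have h1 := P.one_lt s
  have hsin : 0 < Real.sin s := Real.sin_pos_of_mem_Ioo hs
  have hd : 0 < P.b - P.a := by linarith [P.a_lt_b]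
  have e1 : P.xi s ^ (4 / 3 : ℝ) = P.u s ^ 4 := by
    rw [xi, rpow_pow_three hu.le, show (3 : ℝ) * (4 / 3) = (4 : ℕ) by norm_num,
      Real.rpow_natCast]
  have e2 : -1 + P.C * P.xi s ^ 2 = P.C * P.u s ^ 6 - 1 := by rw [xi]; ring
  rw [P.T_xi, e1, e2, Real.sqrt_sq hσ.le, zSpeed, sig]
  field_simp

lemma zero_mem : (0 : ℝ) ∈ Icc 0 Real.pi := ⟨le_rfl, Real.pi_pos.le⟩
lemma pi_mem : Real.pi ∈ Icc 0 Real.pi := ⟨Real.pi_pos.le, le_rfl⟩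

lemma hNeg_eq : hNeg P.C P.Cs = -P.H P.baseAngle := by
  rw [hNeg, xi01_eq, P.h0_xi zero_mem, P.H_zero, zero_sub]

lemma hPos_eq : hPos P.C P.Cs = P.H Real.pi - P.H P.baseAngle := by
  rw [hPos, xi02_eq, P.h0_xi pi_mem]

lemma zetaNeg_eq : zetaNeg P.C = -P.Z P.baseAngle := by
  rw [zetaNeg, xi01_eq, P.zeta0_xi zero_mem, P.Z_zero, zero_sub]

lemma zetaPos_eq : zetaPos P.C = P.Z Real.pi - P.Z P.baseAngle := by
  rw [zetaPos, xi02_eq, P.zeta0_xi pi_mem]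

/-- A function on `[ξ₀₁, ξ₀₂]` that is continuous in the angle is continuous in `ξ`. -/
lemma continuousOn_of_comp_xi {f g : ℝ → ℝ} (hg : Continuous g)
    (hf : ∀ t ∈ Icc 0 Real.pi, f (P.xi t) = g t) :
    ContinuousOn f (Icc (xi01 P.C) (xi02 P.C)) := by
  rw [xi01_eq, xi02_eq]
  refine (hg.comp P.continuous_angle).continuousOn.congr fun ξ hξ => ?_
  rw [Function.comp_apply, ← hf _ (P.angle_mem ξ), P.xi_angle hξ]

lemma xi01_lt_xi02 : xi01 P.C < xi02 P.C := by
  rw [xi01_eq, xi02_eq]; exact P.xi_zero_lt_xi_pi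

lemma tendsto_xi01 {f : ℝ → ℝ} (hf : ContinuousOn f (Icc (xi01 P.C) (xi02 P.C))) :
    Tendsto f (𝓝[>] (xi01 P.C)) (𝓝 (f (xi01 P.C))) := by
  have h := hf (xi01 P.C) ⟨le_rfl, P.xi01_lt_xi02.le⟩
  refine h.tendsto.mono_left ?_
  rw [← nhdsWithin_Ioo_eq_nhdsGT P.xi01_lt_xi02]
  exact nhdsWithin_mono _ Ioo_subset_Icc_self

lemma tendsto_xi02 {f : ℝ → ℝ} (hf : ContinuousOn f (Icc (xi01 P.C) (xi02 P.C))) :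
    Tendsto f (𝓝[<] (xi02 P.C)) (𝓝 (f (xi02 P.C))) := by
  have h := hf (xi02 P.C) ⟨P.xi01_lt_xi02.le, le_rfl⟩
  refine h.tendsto.mono_left ?_
  rw [← nhdsWithin_Ioo_eq_nhdsLT P.xi01_lt_xi02]
  exact nhdsWithin_mono _ Ioo_subset_Icc_self

/-! ### Gluing the pieces -/

/-- The interval of angles of the `k`-th piece. -/
def anglePiece (k : ℤ) : Set ℝ := Icc (k * Real.pi) ((k + 1) * Real.pi)

lemma xi_int_mul_pi_add (k : ℤ) (s : ℝ) :
    P.xi (if Even k then k * Real.pi + s else (k + 1) * Real.pi - s) = P.xi s := by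
  rcases Int.even_or_odd k with hk | hk
  · obtain ⟨m, rfl⟩ := hk.two_dvd
    rw [if_pos hk, ← P.xi_even_mul_pi m s]; congr 1; push_cast; ring
  · obtain ⟨m, rfl⟩ := hk
    rw [if_neg (by simp), ← P.xi_neg s, ← P.xi_even_mul_pi (m + 1) (-s)]
    congr 1; push_cast; ring

/-- Unfolding of the angle intervals: the `k`-th one is a translate or a reflection of `[0, π]`. -/
lemma exists_unfold {k : ℤ} {t : ℝ} (ht : t ∈ anglePiece k) :
    ∃ s ∈ Icc 0 Real.pi, t = if Even k then k * Real.pi + s else (k + 1) * Real.pi - s := by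
  obtain ⟨h1, h2⟩ := ht
  by_cases hk : Even k
  · exact ⟨t - k * Real.pi, ⟨by linarith, by linarith⟩, by rw [if_pos hk]; ring⟩
  · exact ⟨(k + 1) * Real.pi - t, ⟨by linarith, by linarith⟩, by rw [if_neg hk]; ring⟩

lemma unfold_mem (k : ℤ) {s : ℝ} (hs : s ∈ Icc 0 Real.pi) :
    (if Even k then k * Real.pi + s else (k + 1) * Real.pi - s) ∈ anglePiece k := by
  obtain ⟨h1, h2⟩ := hs
  split_ifs
  · exact ⟨by linarith, by linarith⟩
  · exact ⟨by linarith, by linarith⟩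

lemma H_int_mul_pi (k : ℤ) : P.H (k * Real.pi) = k * P.H Real.pi := by
  rcases Int.even_or_odd k with hk | hk
  · obtain ⟨m, rfl⟩ := hk.two_dvd
    have := P.H_even_mul_pi m 0
    rw [P.H_zero] at this
    push_cast; rw [zero_add] at this; rw [this]; ring
  · obtain ⟨m, rfl⟩ := hk
    have := P.H_even_mul_pi m Real.pi
    rw [show Real.pi + 2 * m * Real.pi = ((2 * m + 1 : ℤ) : ℝ) * Real.pi by push_cast; ring] at this
    rw [this]; push_cast; ring

/-- The reflected heights `h_k` are all restrictions of the one function `H`, seen in the angle. -/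
lemma hk_xi {k : ℤ} {t : ℝ} (ht : t ∈ anglePiece k) :
    hk P.C P.Cs k (P.xi t) = P.H t - P.H P.baseAngle := by
  obtain ⟨s, hs, rfl⟩ := exists_unfold ht
  rw [P.xi_int_mul_pi_add, hk, P.h0_xi hs, P.hPos_eq, P.hNeg_eq]
  rcases Int.even_or_odd k with hk | hk
  · obtain ⟨m, rfl⟩ := hk.two_dvd
    rw [if_pos hk, if_pos hk, show ((2 * m : ℤ) : ℝ) * Real.pi + s = s + 2 * m * Real.pi by
      push_cast; ring, P.H_even_mul_pi]
    push_cast; ring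
  · obtain ⟨m, rfl⟩ := hk
    have := P.H_even_mul_pi (m + 1) (-s)
    rw [P.H_neg] at this
    rw [if_neg (by simp), if_neg (by simp),
      show (((2 * m + 1 : ℤ) : ℝ) + 1) * Real.pi - s = -s + 2 * ((m + 1 : ℤ) : ℝ) * Real.pi by
      push_cast; ring, this]
    push_cast; ring

lemma mem_piece_iff {k : ℤ} {t : ℝ} :
    P.H t - P.H P.baseAngle ∈ piece P.C P.Cs k ↔ t ∈ anglePiece k := by
  have h1 := P.H_int_mul_pi k
  have h2 := P.H_int_mul_pi (k + 1)
  push_cast at h2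
  have e1 : hNeg P.C P.Cs + k * (hPos P.C P.Cs - hNeg P.C P.Cs)
      = P.H (k * Real.pi) - P.H P.baseAngle := by rw [h1, P.hPos_eq, P.hNeg_eq]; ring
  have e2 : hPos P.C P.Cs + k * (hPos P.C P.Cs - hNeg P.C P.Cs)
      = P.H ((k + 1) * Real.pi) - P.H P.baseAngle := by rw [h2, P.hPos_eq, P.hNeg_eq]; ring
  rw [piece, e1, e2, anglePiece, mem_Icc, mem_Icc, sub_le_sub_iff_right, sub_le_sub_iff_right,
    P.strictMono_H.le_iff_le, P.strictMono_H.le_iff_le]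

/-- The angle at height `h`. -/
def tau (h : ℝ) : ℝ := P.heightHomeomorph.symm (h + P.H P.baseAngle)

lemma H_tau (h : ℝ) : P.H (P.tau h) - P.H P.baseAngle = h := by
  rw [tau, H_symm_apply]; ring

lemma tau_H (t : ℝ) : P.tau (P.H t - P.H P.baseAngle) = t :=
  P.strictMono_H.injective (by have := P.H_tau (P.H t - P.H P.baseAngle); linarith)

lemma tau_mem_iff {k : ℤ} {h : ℝ} : P.tau h ∈ anglePiece k ↔ h ∈ piece P.C P.Cs k := by
  rw [← P.mem_piece_iff, P.H_tau]

lemma bijOn_hk (k : ℤ) :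
    BijOn (hk P.C P.Cs k) (Icc (xi01 P.C) (xi02 P.C)) (piece P.C P.Cs k) := by
  rw [xi01_eq, xi02_eq]
  have hval : ∀ s ∈ Icc 0 Real.pi, hk P.C P.Cs k (P.xi s)
      = P.H (if Even k then k * Real.pi + s else (k + 1) * Real.pi - s) - P.H P.baseAngle :=
    fun s hs => by rw [← P.xi_int_mul_pi_add k s, P.hk_xi (unfold_mem k hs)]
  refine ⟨?_, ?_, ?_⟩
  · intro ξ hξ
    obtain ⟨s, hs, rfl⟩ := P.bijOn_xi.surjOn hξ
    rw [hval s hs, P.mem_piece_iff]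
    exact unfold_mem k hs
  · intro ξ hξ η hη heq
    obtain ⟨s, hs, rfl⟩ := P.bijOn_xi.surjOn hξ
    obtain ⟨r, hr, rfl⟩ := P.bijOn_xi.surjOn hη
    rw [hval s hs, hval r hr, sub_left_inj] at heq
    have := P.strictMono_H.injective heq
    congr 1
    split_ifs at this <;> linarith
  · intro h hh
    obtain ⟨s, hs, hst⟩ := exists_unfold (P.tau_mem_iff.2 hh)
    refine ⟨P.xi s, P.bijOn_xi.mapsTo hs, ?_⟩
    rw [hval s hs, ← hst, P.H_tau]

lemma L_pos : 0 < hPos P.C P.Cs - hNeg P.C P.Cs := by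
  rw [P.hPos_eq, P.hNeg_eq]; linarith [P.H_pi_pos]

lemma mem_piece_pieceIndex (h : ℝ) : h ∈ piece P.C P.Cs (pieceIndex P.C P.Cs h) := by
  have hL := P.L_pos
  have h1 := Int.floor_le ((h - hNeg P.C P.Cs) / (hPos P.C P.Cs - hNeg P.C P.Cs))
  have h2 := Int.lt_floor_add_one ((h - hNeg P.C P.Cs) / (hPos P.C P.Cs - hNeg P.C P.Cs))
  rw [le_div_iff₀ hL] at h1
  rw [div_lt_iff₀ hL] at h2
  constructor
  · unfold pieceIndex; linarith
  · unfold pieceIndex; linarith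

lemma xi_mem_Icc (t : ℝ) : P.xi t ∈ Icc (xi01 P.C) (xi02 P.C) := by
  rw [xi01_eq, xi02_eq]
  have hu : ∀ s r, P.y s ≤ P.y r → P.xi s ≤ P.xi r := fun s r h =>
    pow_le_pow_left₀ (P.u_pos s).le (Real.sqrt_le_sqrt h) 3
  exact ⟨hu _ _ (by rw [y_zero]; exact P.a_le_y t), hu _ _ (by rw [y_pi]; exact P.y_le_b t)⟩

/-- The glued inverse of the `h_k` is `ξ` as a function of the angle, composed with the angle as a
function of the height. -/
lemma F_eq (h : ℝ) : F P.C P.Cs h = P.xi (P.tau h) := by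
  have hm := P.tau_mem_iff.2 (P.mem_piece_pieceIndex h)
  have hh : hk P.C P.Cs (pieceIndex P.C P.Cs h) (P.xi (P.tau h)) = h := by
    rw [P.hk_xi hm, P.H_tau]
  have := (P.bijOn_hk (pieceIndex P.C P.Cs h)).injOn.leftInvOn_invFunOn (P.xi_mem_Icc (P.tau h))
  rwa [hh] at this

lemma F_hk (k : ℤ) {ξ : ℝ} (hξ : ξ ∈ Icc (xi01 P.C) (xi02 P.C)) :
    F P.C P.Cs (hk P.C P.Cs k ξ) = ξ := by
  rw [xi01_eq, xi02_eq] at hξ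
  obtain ⟨s, hs, rfl⟩ := P.bijOn_xi.surjOn hξ
  rw [F_eq, ← P.xi_int_mul_pi_add k s, P.hk_xi (unfold_mem k hs), P.tau_H]

lemma contDiff_tau : ContDiff ℝ 4 P.tau :=
  P.contDiff_heightHomeomorph_symm.comp (contDiff_id.add contDiff_const)

lemma hasDerivAt_tau (h : ℝ) : HasDerivAt P.tau (P.hSpeed (P.tau h))⁻¹ h := by
  refine HasDerivAt.of_local_left_inverse P.contDiff_tau.continuous.continuousAt
    (f := fun t => P.H t - P.H P.baseAngle) ((P.hasDerivAt_H _).sub_const _)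
    (P.hSpeed_pos _).ne' (Eventually.of_forall P.H_tau)

lemma tau_add_period (h : ℝ) :
    P.tau (h + 2 * (hPos P.C P.Cs - hNeg P.C P.Cs)) = P.tau h + 2 * Real.pi := by
  have h1 := P.H_even_mul_pi 1 (P.tau h)
  have h2 := P.H_tau h
  rw [← P.tau_H (P.tau h + 2 * Real.pi)]
  congr 1
  rw [show P.tau h + 2 * Real.pi = P.tau h + 2 * ((1 : ℤ) : ℝ) * Real.pi by push_cast; ring, h1,
    P.hPos_eq, P.hNeg_eq]
  push_cast; linarith

lemma contDiff_F : ContDiff ℝ 3 (F P.C P.Cs) := by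
  rw [show F P.C P.Cs = fun h => P.u (P.tau h) ^ 3 from funext P.F_eq]
  have h1 : ContDiff ℝ 3 P.tau := P.contDiff_tau.of_le (by norm_num)
  exact (P.contDiff_u.comp h1).pow 3

lemma periodic_F : Function.Periodic (F P.C P.Cs) (2 * (hPos P.C P.Cs - hNeg P.C P.Cs)) :=
  fun h => by rw [F_eq, F_eq, tau_add_period, xi_add_two_pi]

lemma isWellDefined : IsWellDefined P.C P.Cs where
  zeros ξ hξ := by rw [xi01_eq, xi02_eq]; exact P.T_eq_zero_iff hξ
  pos := by rw [xi01_eq]; exact P.xi_pos 0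
  lt_base := by
    rw [xi01_eq, xi00_eq]
    exact P.xi_lt_xi_of_y_lt_y (by rw [y_zero, y_baseAngle]; exact P.a_lt_base)
  base_lt := by
    rw [xi02_eq, xi00_eq]
    exact P.xi_lt_xi_of_y_lt_y (by rw [y_pi, y_baseAngle]; exact P.base_lt_b)
  tendsto_zetaNeg := P.tendsto_xi01 <| P.continuousOn_of_comp_xi
    (P.contDiff_Z.continuous.sub continuous_const) fun _ => P.zeta0_xi
  tendsto_zetaPos := P.tendsto_xi02 <| P.continuousOn_of_comp_xi
    (P.contDiff_Z.continuous.sub continuous_const) fun _ => P.zeta0_xi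
  tendsto_hNeg := P.tendsto_xi01 <| P.continuousOn_of_comp_xi
    (P.contDiff_H.continuous.sub continuous_const) fun _ => P.h0_xi
  tendsto_hPos := P.tendsto_xi02 <| P.continuousOn_of_comp_xi
    (P.contDiff_H.continuous.sub continuous_const) fun _ => P.h0_xi
  hNeg_lt_hPos := by linarith [P.L_pos]
  bijOn := P.bijOn_hk

/-- The smooth phase angle of the profile curve at height `h`. -/
def psi (c₀ h : ℝ) : ℝ := P.Z (P.tau h) - P.Z P.baseAngle + c₀

lemma contDiff_psi (c₀ : ℝ) : ContDiff ℝ 4 (P.psi c₀) :=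
  ((P.contDiff_Z.comp P.contDiff_tau).sub contDiff_const).add contDiff_const

/-- The conditions on the constants `c_k` say exactly that the phases of the pieces are the
restrictions of one function, modulo `2π` and up to the orientation `(-1) ^ k`. -/
lemma exists_phase_eq {c : ℤ → ℝ} (hc : IsPhaseSequence P.C c) {k : ℤ} {h : ℝ}
    (hh : h ∈ piece P.C P.Cs k) :
    ∃ n : ℤ, (-1) ^ k * (zeta0 P.C (F P.C P.Cs h) + c k) = P.psi (c 0) h + n * (2 * Real.pi) := by
  obtain ⟨s, hs, hst⟩ := exists_unfold (P.tau_mem_iff.2 hh)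
  rw [F_eq, psi, hst, P.xi_int_mul_pi_add, P.zeta0_xi hs]
  rcases Int.even_or_odd k with hk | hk
  · have hmod := (hc k).1 hk
    rw [AddCommGroup.modEq_iff_zsmul'] at hmod
    obtain ⟨n, hn⟩ := hmod
    rw [P.zetaPos_eq, P.zetaNeg_eq, zsmul_eq_mul] at hn
    rw [hk.neg_one_zpow, if_pos hk]
    obtain ⟨m, rfl⟩ := hk.two_dvd
    refine ⟨-n, ?_⟩
    rw [show ((2 * m : ℤ) : ℝ) * Real.pi + s = s + 2 * m * Real.pi by push_cast; ring,
      P.Z_even_mul_pi]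
    push_cast at hn ⊢
    linear_combination -hn
  · have hmod := (hc k).2 hk
    rw [AddCommGroup.modEq_iff_zsmul'] at hmod
    obtain ⟨n, hn⟩ := hmod
    rw [P.zetaPos_eq, P.zetaNeg_eq, zsmul_eq_mul] at hn
    rw [hk.neg_one_zpow, if_neg (by simpa using hk)]
    obtain ⟨m, rfl⟩ := hk
    refine ⟨n, ?_⟩
    have hZ := P.Z_even_mul_pi (m + 1) (-s)
    rw [P.Z_neg] at hZ
    rw [show (((2 * m + 1 : ℤ) : ℝ) + 1) * Real.pi - s = -s + 2 * ((m + 1 : ℤ) : ℝ) * Real.pi by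
      push_cast; ring, hZ]
    push_cast at hn ⊢
    linear_combination hn

lemma cos_sin_phase {c : ℤ → ℝ} (hc : IsPhaseSequence P.C c) {k : ℤ} {h : ℝ}
    (hh : h ∈ piece P.C P.Cs k) :
    Real.cos (zeta0 P.C (F P.C P.Cs h) + c k) = Real.cos (P.psi (c 0) h) ∧
      (-1) ^ k * Real.sin (zeta0 P.C (F P.C P.Cs h) + c k) = Real.sin (P.psi (c 0) h) := by
  obtain ⟨n, hn⟩ := P.exists_phase_eq hc hh
  have hcos := congrArg Real.cos hn
  have hsin := congrArg Real.sin hn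
  rw [Real.cos_add_int_mul_two_pi] at hcos
  rw [Real.sin_add_int_mul_two_pi] at hsin
  rw [← hcos, ← hsin]
  rcases Int.even_or_odd k with hk | hk
  · simp [hk.neg_one_zpow]
  · simp only [hk.neg_one_zpow, neg_mul, one_mul, Real.cos_neg, Real.sin_neg, and_self]

/-- The radius `√(1 - 1 / (C F²))` of the first circle, as a function of the height. -/
def rho (h : ℝ) : ℝ := √(1 - 1 / (P.C * F P.C P.Cs h ^ 2))

lemma Phi1k_eq {c : ℤ → ℝ} (hc : IsPhaseSequence P.C c) {k : ℤ} {h : ℝ}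
    (hh : h ∈ piece P.C P.Cs k) :
    Phi1k P.C c k (F P.C P.Cs h) = P.rho h * Real.cos (P.psi (c 0) h) := by
  rw [Phi1k, (P.cos_sin_phase hc hh).1, rho]

lemma Phi2k_eq {c : ℤ → ℝ} (hc : IsPhaseSequence P.C c) {k : ℤ} {h : ℝ}
    (hh : h ∈ piece P.C P.Cs k) :
    Phi2k P.C c k (F P.C P.Cs h) = P.rho h * Real.sin (P.psi (c 0) h) := by
  rw [Phi2k, ← (P.cos_sin_phase hc hh).2, rho]; ring

lemma Phi1_eq {c : ℤ → ℝ} (hc : IsPhaseSequence P.C c) (h : ℝ) :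
    Phi1 P.C P.Cs c h = P.rho h * Real.cos (P.psi (c 0) h) :=
  P.Phi1k_eq hc (P.mem_piece_pieceIndex h)

lemma Phi2_eq {c : ℤ → ℝ} (hc : IsPhaseSequence P.C c) (h : ℝ) :
    Phi2 P.C P.Cs c h = P.rho h * Real.sin (P.psi (c 0) h) :=
  P.Phi2k_eq hc (P.mem_piece_pieceIndex h)

lemma PhiMap_eq_PhiLocal {c : ℤ → ℝ} (hc : IsPhaseSequence P.C c) {k : ℤ} {h : ℝ}
    (hh : h ∈ piece P.C P.Cs k) (θ : ℝ) :
    PhiMap P.C P.Cs c (h, θ) = PhiLocal P.C ((-1) ^ k) (c k) (F P.C P.Cs h) θ := by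
  obtain ⟨n, hn⟩ := P.exists_phase_eq hc hh
  rw [PhiMap, PhiLocal, hn, Real.cos_add_int_mul_two_pi, Real.sin_add_int_mul_two_pi,
    P.Phi1_eq hc, P.Phi2_eq hc, Phi3, Phi4, rho, one_div_mul_eq_div, one_div_mul_eq_div]

end Profile

/-! ### Completeness of metrics comparable with the flat one -/

open MeasureTheory in
/-- A metric bounded below by a multiple of the flat one has larger distances, up to that
multiple. -/
lemma mul_edist_le_riemDist {G : PlaneMetric} {k : ℝ} (hk : 0 ≤ k)
    (hlow : ∀ p v, (k * ‖v‖) ^ 2 ≤ quadForm G p v) (p q : ℝ × ℝ) :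
    ENNReal.ofReal k * edist p q ≤ riemDist G p q := by
  let _ : ∀ x : ℝ × ℝ, ENorm (TangentSpace (modelWithCornersSelf ℝ (ℝ × ℝ)) x) :=
    fun x => ⟨fun v => ENNReal.ofReal (√(quadForm G x v))⟩
  change _ ≤ Manifold.riemannianEDist (modelWithCornersSelf ℝ (ℝ × ℝ)) p q
  refine le_of_forall_gt fun r hr => ?_
  obtain ⟨γ, h0, h1, hγ, hlt⟩ := Manifold.exists_lt_of_riemannianEDist_lt hr
  refine lt_of_le_of_lt ?_ hlt
  rw [contMDiffOn_iff_contDiffOn] at hγ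
  rw [Manifold.pathELength_eq_lintegral_mfderivWithin_Icc]
  simp only [mfderivWithin_eq_fderivWithin]
  have hdist : edist p q ≤ ∫⁻ t in Icc (0 : ℝ) 1, ‖derivWithin γ (Icc 0 1) t‖ₑ := by
    rw [edist_comm, edist_eq_enorm_sub, ← h0, ← h1]
    exact enorm_sub_le_lintegral_derivWithin_Icc_of_contDiffOn_Icc hγ zero_le_one
  refine (mul_le_mul_right hdist _).trans ?_
  rw [← lintegral_const_mul' _ _ ENNReal.ofReal_ne_top]
  refine lintegral_mono fun t => ?_
  change _ ≤ ENNReal.ofReal (√(quadForm G (γ t) (fderivWithin ℝ γ (Icc 0 1) t 1)))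
  rw [← ofReal_norm, ← ENNReal.ofReal_mul hk, fderivWithin_derivWithin]
  exact ENNReal.ofReal_le_ofReal (Real.le_sqrt_of_sq_le (hlow _ _))

lemma quadForm_smul (G : PlaneMetric) (p v : ℝ × ℝ) (c : ℝ) :
    quadForm G p (c • v) = c ^ 2 * quadForm G p v := by
  simp [quadForm, Fin.sum_univ_two]; ring

open MeasureTheory in
/-- A metric bounded above by a multiple of the flat one has smaller distances, up to that
multiple. -/
lemma riemDist_le_mul_edist {G : PlaneMetric} {K : ℝ} (hK : 0 ≤ K)
    (hup : ∀ p v, quadForm G p v ≤ (K * ‖v‖) ^ 2) (p q : ℝ × ℝ) :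
    riemDist G p q ≤ ENNReal.ofReal K * edist p q := by
  let _ : ∀ x : ℝ × ℝ, ENorm (TangentSpace (modelWithCornersSelf ℝ (ℝ × ℝ)) x) :=
    fun x => ⟨fun v => ENNReal.ofReal (√(quadForm G x v))⟩
  have _ : ∀ x : ℝ × ℝ, ENormSMulClass ℝ (TangentSpace (modelWithCornersSelf ℝ (ℝ × ℝ)) x) :=
    fun x => ⟨fun c v => by
      change ENNReal.ofReal (√(quadForm G x (c • (show ℝ × ℝ from v)))) =
        ‖c‖ₑ * ENNReal.ofReal (√(quadForm G x v))
      rw [quadForm_smul, Real.sqrt_mul (sq_nonneg c), Real.sqrt_sq_eq_abs,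
        ENNReal.ofReal_mul (abs_nonneg c), Real.enorm_eq_ofReal_abs]⟩
  change Manifold.riemannianEDist (modelWithCornersSelf ℝ (ℝ × ℝ)) p q ≤ _
  let γ := ContinuousAffineMap.lineMap (R := ℝ) p q
  have hle : Manifold.riemannianEDist (modelWithCornersSelf ℝ (ℝ × ℝ)) p q
      ≤ Manifold.pathELength (modelWithCornersSelf ℝ (ℝ × ℝ)) γ 0 1 := by
    apply Manifold.riemannianEDist_le_pathELength ?_
      (by simp [γ, ContinuousAffineMap.coe_lineMap_eq])
      (by simp [γ, ContinuousAffineMap.coe_lineMap_eq]) zero_le_one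
    rw [contMDiffOn_iff_contDiffOn]
    exact γ.contDiff.contDiffOn
  refine hle.trans ?_
  rw [Manifold.pathELength_eq_lintegral_mfderivWithin_Icc]
  simp only [mfderivWithin_eq_fderivWithin]
  rw [← lintegral_fderiv_lineMap_eq_edist, ← lintegral_const_mul' _ _ ENNReal.ofReal_ne_top]
  refine lintegral_mono fun t => ?_
  change ENNReal.ofReal (√(quadForm G (γ t) (fderivWithin ℝ γ (Icc 0 1) t 1))) ≤ _
  rw [← ofReal_norm, ← ENNReal.ofReal_mul hK]
  exact ENNReal.ofReal_le_ofReal (Real.sqrt_le_iff.2 ⟨by positivity, hup _ _⟩)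

/-- A metric on the plane pinched between two multiples of the flat one is complete, because its
distance has the same Cauchy sequences and the same limits as the usual one. -/
lemma isCompleteMetric_of_pinched {G : PlaneMetric} {k K : ℝ} (hk : 0 < k) (hK : 0 ≤ K)
    (hlow : ∀ p v, (k * ‖v‖) ^ 2 ≤ quadForm G p v)
    (hup : ∀ p v, quadForm G p v ≤ (K * ‖v‖) ^ 2) : IsCompleteMetric G := by
  intro v hv
  have hk' : ENNReal.ofReal k ≠ 0 := by simpa using hk
  have hcau : CauchySeq v := by
    rw [EMetric.cauchySeq_iff]
    intro ε hε
    obtain ⟨N, hN⟩ := hv (ENNReal.ofReal k * ε) (ENNReal.mul_pos hk' hε.ne')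
    refine ⟨N, fun m hm n hn => ?_⟩
    have := (mul_edist_le_riemDist hk.le hlow (v m) (v n)).trans_lt (hN m hm n hn)
    exact (ENNReal.mul_lt_mul_iff_right hk' ENNReal.ofReal_ne_top).1 this
  obtain ⟨a, ha⟩ := cauchySeq_tendsto_of_complete hcau
  refine ⟨a, ?_⟩
  have h1 : Tendsto (fun n => ENNReal.ofReal K * edist (v n) a) atTop
      (𝓝 (ENNReal.ofReal K * 0)) :=
    ENNReal.Tendsto.const_mul (tendsto_iff_edist_tendsto_0.1 ha) (Or.inr ENNReal.ofReal_ne_top)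
  rw [mul_zero] at h1
  exact tendsto_of_tendsto_of_tendsto_of_le_of_le tendsto_const_nhds h1 (fun _ => zero_le)
    fun n => riemDist_le_mul_edist hK hup _ _

/-- The metric `E(h) dh² + Q(h) dθ²`. -/
def diagMetric (E Q : ℝ → ℝ) : PlaneMetric := fun p => !![E p.1, 0; 0, Q p.1]

/-- A diagonal metric whose coefficients lie between two positive constants is complete. -/
lemma isCompleteMetric_diagonal {E Q : ℝ → ℝ} {m M : ℝ} (hm : 0 < m)
    (hE : ∀ h, m ≤ E h ∧ E h ≤ M) (hQ : ∀ h, m ≤ Q h ∧ Q h ≤ M) :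
    IsCompleteMetric (diagMetric E Q) := by
  have hM : 0 < M := hm.trans_le ((hE 0).1.trans (hE 0).2)
  have hq : ∀ p v : ℝ × ℝ, quadForm (diagMetric E Q) p v
      = E p.1 * v.1 ^ 2 + Q p.1 * v.2 ^ 2 := fun p v => by
    simp [quadForm, diagMetric, Fin.sum_univ_two]; ring
  refine isCompleteMetric_of_pinched (k := √m) (K := √(2 * M)) (by positivity) (by positivity)
    (fun p v => ?_) (fun p v => ?_)
  · rw [hq, mul_pow, Real.sq_sqrt hm.le]
    have h1 := mul_le_mul_of_nonneg_right (hE p.1).1 (sq_nonneg v.1)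
    have h2 := mul_le_mul_of_nonneg_right (hQ p.1).1 (sq_nonneg v.2)
    have h3 : ‖v‖ ^ 2 ≤ v.1 ^ 2 + v.2 ^ 2 := by
      rcases max_choice ‖v.1‖ ‖v.2‖ with h | h
      · rw [Prod.norm_def, h, Real.norm_eq_abs, sq_abs]; nlinarith [sq_nonneg v.2]
      · rw [Prod.norm_def, h, Real.norm_eq_abs, sq_abs]; nlinarith [sq_nonneg v.1]
    nlinarith
  · rw [hq, mul_pow, Real.sq_sqrt (by positivity)]
    have h1 := mul_le_mul_of_nonneg_right (hE p.1).2 (sq_nonneg v.1)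
    have h2 := mul_le_mul_of_nonneg_right (hQ p.1).2 (sq_nonneg v.2)
    have h3 : v.1 ^ 2 ≤ ‖v‖ ^ 2 := sq_le_sq' (by
      have := norm_fst_le v; rw [Real.norm_eq_abs] at this; linarith [neg_abs_le v.1])
      ((le_abs_self _).trans (norm_fst_le v))
    have h4 : v.2 ^ 2 ≤ ‖v‖ ^ 2 := sq_le_sq' (by
      have := norm_snd_le v; rw [Real.norm_eq_abs] at this; linarith [neg_abs_le v.2])
      ((le_abs_self _).trans (norm_snd_le v))
    nlinarith

/-! ### Partial derivatives in the coordinate plane -/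

section PartialDerivatives

variable {V : Type*} [NormedAddCommGroup V] [NormedSpace ℝ V]

lemma pd_zero_comp_fst {f : ℝ → V} {p : ℝ × ℝ} (hf : DifferentiableAt ℝ f p.1) :
    pd 0 (fun q : ℝ × ℝ => f q.1) p = deriv f p.1 := by
  have h : HasFDerivAt (fun q : ℝ × ℝ => f q.1) _ p :=
    hf.hasDerivAt.hasFDerivAt.comp p hasFDerivAt_fst
  rw [pd, h.fderiv]; simp [basisVec]

lemma pd_one_comp_fst {f : ℝ → V} {p : ℝ × ℝ} (hf : DifferentiableAt ℝ f p.1) :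
    pd 1 (fun q : ℝ × ℝ => f q.1) p = 0 := by
  have h : HasFDerivAt (fun q : ℝ × ℝ => f q.1) _ p :=
    hf.hasDerivAt.hasFDerivAt.comp p hasFDerivAt_fst
  rw [pd, h.fderiv]; simp [basisVec]

lemma pd_const (i : Fin 2) (v : V) (p : ℝ × ℝ) : pd i (fun _ => v) p = 0 := by simp [pd]

lemma pd_inner {V : Type*} [NormedAddCommGroup V] [InnerProductSpace ℝ V] {X Y : ℝ × ℝ → V}
    {p : ℝ × ℝ} (hX : DifferentiableAt ℝ X p) (hY : DifferentiableAt ℝ Y p) (i : Fin 2) :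
    pd i (fun q => (inner ℝ (X q) (Y q) : ℝ)) p
      = inner ℝ (X p) (pd i Y p) + inner ℝ (pd i X p) (Y p) :=
  fderiv_inner_apply ℝ hX hY _

lemma pd_smul {f : ℝ × ℝ → ℝ} {X : ℝ × ℝ → V} {p : ℝ × ℝ} (hf : DifferentiableAt ℝ f p)
    (hX : DifferentiableAt ℝ X p) (i : Fin 2) :
    pd i (fun q => f q • X q) p = f p • pd i X p + pd i f p • X p := by
  simp only [pd]
  rw [fderiv_fun_smul hf hX]
  simp

lemma contDiff_pd {φ : ℝ × ℝ → V} {n m : WithTop ℕ∞} (hφ : ContDiff ℝ n φ) (h : m + 1 ≤ n)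
    (i : Fin 2) : ContDiff ℝ m (pd i φ) :=
  (hφ.fderiv_right h).clm_apply contDiff_const

lemma pd_comm {φ : ℝ × ℝ → V} (hφ : ContDiff ℝ 2 φ) (i j : Fin 2) (p : ℝ × ℝ) :
    pd i (pd j φ) p = pd j (pd i φ) p := by
  have hd : DifferentiableAt ℝ (fderiv ℝ φ) p :=
    (hφ.fderiv_right (m := 1) (by norm_num)).differentiable (by norm_num) p
  have key : ∀ k l : Fin 2, pd k (pd l φ) p
      = fderiv ℝ (fderiv ℝ φ) p (basisVec k) (basisVec l) := fun k l => by
    have h := hd.hasFDerivAt.clm_apply (hasFDerivAt_const (basisVec l) p)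
    rw [pd, show pd l φ = fun q => fderiv ℝ φ q (basisVec l) from rfl, h.fderiv]
    simp
  rw [key, key]
  exact (hφ.contDiffAt.isSymmSndFDerivAt (by simp)) _ _

end PartialDerivatives

/-! ### Diagonal metrics depending on one coordinate -/

section Diagonal

variable {E Q : ℝ → ℝ}

lemma diagMetric_inv {p : ℝ × ℝ} (hE : 0 < E p.1) (hQ : 0 < Q p.1) :
    (diagMetric E Q p)⁻¹ = !![1 / E p.1, 0; 0, 1 / Q p.1] := by
  refine Matrix.inv_eq_right_inv ?_
  rw [diagMetric, Matrix.mul_fin_two, Matrix.one_fin_two]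
  simp [hE.ne', hQ.ne']

lemma pd_diagMetric {p : ℝ × ℝ} (hE : DifferentiableAt ℝ E p.1) (hQ : DifferentiableAt ℝ Q p.1)
    (i j k : Fin 2) : pd k (fun q => diagMetric E Q q i j) p
      = !![if k = 0 then deriv E p.1 else 0, 0; 0, if k = 0 then deriv Q p.1 else 0] i j := by
  have h1 := pd_zero_comp_fst hE
  have h2 := pd_one_comp_fst hE
  have h3 := pd_zero_comp_fst hQ
  have h4 := pd_one_comp_fst hQ
  have h5 := fun k => pd_const k (0 : ℝ) p
  fin_cases i <;> fin_cases j <;> fin_cases k <;> simp [diagMetric, h1, h2, h3, h4, h5]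

/-- The Christoffel symbols of `E(h) dh² + Q(h) dθ²`. -/
lemma christoffel_diagMetric {p : ℝ × ℝ} (hE : 0 < E p.1) (hQ : 0 < Q p.1)
    (hE' : DifferentiableAt ℝ E p.1) (hQ' : DifferentiableAt ℝ Q p.1) (k i j : Fin 2) :
    christoffel (diagMetric E Q) k i j p
      = ![!![deriv E p.1 / (2 * E p.1), 0; 0, -deriv Q p.1 / (2 * E p.1)],
          !![0, deriv Q p.1 / (2 * Q p.1); deriv Q p.1 / (2 * Q p.1), 0]] k i j := by
  have h1 := hE.ne'
  have h2 := hQ.ne'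
  simp only [christoffel, pd_diagMetric hE' hQ', diagMetric_inv hE hQ, Fin.sum_univ_two]
  fin_cases i <;> fin_cases j <;> fin_cases k <;> simp <;> field_simp

end Diagonal

/-! ### Biconservativity from the principal curvatures -/

/-- A vector of `ℝ⁴` orthogonal to four non-zero pairwise orthogonal vectors vanishes. -/
lemma eq_zero_of_inner_eq_zero {b : Fin 4 → E4} (hb : ∀ i, b i ≠ 0)
    (ho : Pairwise fun i j => (inner ℝ (b i) (b j) : ℝ) = 0) {v : E4}
    (hv : ∀ i, (inner ℝ (b i) v : ℝ) = 0) : v = 0 := by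
  have hli : LinearIndependent ℝ b := linearIndependent_of_ne_zero_of_inner_eq_zero hb ho
  have hspan := hli.span_eq_top_of_card_eq_finrank (by simp)
  have hmem : v ∈ Submodule.span ℝ (range b) := by rw [hspan]; trivial
  have : ∀ w ∈ Submodule.span ℝ (range b), (inner ℝ w v : ℝ) = 0 := fun w hw => by
    induction hw using Submodule.span_induction with
    | mem x hx => obtain ⟨i, rfl⟩ := hx; exact hv i
    | zero => simp
    | add x y _ _ hx hy => rw [inner_add_left, hx, hy, add_zero]
    | smul r x _ hx => rw [inner_smul_left, hx, mul_zero]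
  exact inner_self_eq_zero.1 (this v hmem)

/-- `φ` is an isometric immersion of `(ℝ², E(h) dh² + Q(h) dθ²)` into `𝕊³` with unit normal field
`N`, for which the coordinate directions are principal with curvatures `-f/2` and `3f/2`
(so that `f` is the trace of the shape operator). -/
structure IsPrincipalFrame (E Q f : ℝ → ℝ) (φ N : ℝ × ℝ → E4) : Prop where
  E_pos : ∀ h, 0 < E h
  Q_pos : ∀ h, 0 < Q h
  diff_E : Differentiable ℝ E
  diff_Q : Differentiable ℝ Q
  diff_f : Differentiable ℝ f
  contDiff_φ : ContDiff ℝ 2 φ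
  diff_N : Differentiable ℝ N
  inner_φ_φ : ∀ p, (inner ℝ (φ p) (φ p) : ℝ) = 1
  metric : ∀ p i j, (inner ℝ (pd i φ p) (pd j φ p) : ℝ) = diagMetric E Q p i j
  inner_N_N : ∀ p, (inner ℝ (N p) (N p) : ℝ) = 1
  inner_φ_N : ∀ p, (inner ℝ (φ p) (N p) : ℝ) = 0
  inner_pd_N : ∀ p i, (inner ℝ (pd i φ p) (N p) : ℝ) = 0
  pd_zero_N : ∀ p, pd 0 N p = (f p.1 / 2) • pd 0 φ p
  pd_one_N : ∀ p, pd 1 N p = -(3 / 2 * f p.1) • pd 1 φ p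

namespace IsPrincipalFrame

variable {E Q f : ℝ → ℝ} {φ N : ℝ × ℝ → E4} (W : IsPrincipalFrame E Q f φ N)
include W

lemma diff_φ : Differentiable ℝ φ := W.contDiff_φ.differentiable (by norm_num)

lemma diff_pd (i : Fin 2) : Differentiable ℝ (pd i φ) :=
  (contDiff_pd (m := 1) W.contDiff_φ (by norm_num) i).differentiable (by norm_num)

lemma inner_φ_pd (p : ℝ × ℝ) (i : Fin 2) : (inner ℝ (φ p) (pd i φ p) : ℝ) = 0 := by
  have h := pd_inner (W.diff_φ p) (W.diff_φ p) i
  simp only [W.inner_φ_φ, pd_const] at h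
  rw [real_inner_comm (φ p)] at h
  linarith

lemma inner_pd_pd_N (p : ℝ × ℝ) (i j : Fin 2) :
    (inner ℝ (pd i (pd j φ) p) (N p) : ℝ) = -inner ℝ (pd j φ p) (pd i N p) := by
  have h := pd_inner (W.diff_pd j p) (W.diff_N p) i
  simp only [W.inner_pd_N, pd_const] at h
  linarith

lemma pd_metric (p : ℝ × ℝ) (i j k : Fin 2) :
    (inner ℝ (pd i φ p) (pd k (pd j φ) p) : ℝ) + inner ℝ (pd k (pd i φ) p) (pd j φ p)
      = !![if k = 0 then deriv E p.1 else 0, 0; 0, if k = 0 then deriv Q p.1 else 0] i j := by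
  rw [← pd_diagMetric (W.diff_E _) (W.diff_Q _), ← pd_inner (W.diff_pd i p) (W.diff_pd j p)]
  simp only [W.metric]

lemma inner_φ₀₀_φ₀ (p : ℝ × ℝ) :
    (inner ℝ (pd 0 (pd 0 φ) p) (pd 0 φ p) : ℝ) = deriv E p.1 / 2 := by
  have h := W.pd_metric p 0 0 0
  rw [real_inner_comm] at h
  simp at h; linarith

lemma inner_φ₁₁_φ₁ (p : ℝ × ℝ) : (inner ℝ (pd 1 (pd 1 φ) p) (pd 1 φ p) : ℝ) = 0 := by
  have h := W.pd_metric p 1 1 1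
  rw [real_inner_comm] at h
  simp at h; linarith

lemma inner_φ₀₀_φ₁ (p : ℝ × ℝ) : (inner ℝ (pd 0 (pd 0 φ) p) (pd 1 φ p) : ℝ) = 0 := by
  have h := W.pd_metric p 0 1 0
  have h' := W.pd_metric p 0 0 1
  rw [real_inner_comm (pd 1 (pd 0 φ) p)] at h'
  rw [pd_comm W.contDiff_φ 0 1, real_inner_comm (pd 1 (pd 0 φ) p)] at h
  simp at h h'; linarith

lemma inner_φ₁₁_φ₀ (p : ℝ × ℝ) :
    (inner ℝ (pd 1 (pd 1 φ) p) (pd 0 φ p) : ℝ) = -deriv Q p.1 / 2 := by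
  have h := W.pd_metric p 1 0 1
  have h' := W.pd_metric p 1 1 0
  rw [pd_comm W.contDiff_φ 1 0] at h
  rw [real_inner_comm (pd 0 (pd 1 φ) p)] at h' h
  simp at h h'; linarith

/-- The Gauss formula: the tension field is the normal field `f N`. -/
lemma tension_eq (p : ℝ × ℝ) : tension (diagMetric E Q) φ p = f p.1 • N p := by
  have hE := W.E_pos p.1
  have hQ := W.Q_pos p.1
  have m00 : (inner ℝ (pd 0 φ p) (pd 0 φ p) : ℝ) = E p.1 := W.metric p 0 0
  have m11 : (inner ℝ (pd 1 φ p) (pd 1 φ p) : ℝ) = Q p.1 := W.metric p 1 1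
  have m01 : (inner ℝ (pd 0 φ p) (pd 1 φ p) : ℝ) = 0 := W.metric p 0 1
  have m10 : (inner ℝ (pd 1 φ p) (pd 0 φ p) : ℝ) = 0 := W.metric p 1 0
  have hN0 : (inner ℝ (pd 0 (pd 0 φ) p) (N p) : ℝ) = -(f p.1 / 2 * E p.1) := by
    rw [W.inner_pd_pd_N, W.pd_zero_N, inner_smul_right, m00]
  have hN1 : (inner ℝ (pd 1 (pd 1 φ) p) (N p) : ℝ) = 3 / 2 * f p.1 * Q p.1 := by
    rw [W.inner_pd_pd_N, W.pd_one_N, inner_smul_right, m11]; ring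
  have h1 := W.inner_φ_pd p
  have h1' : ∀ i, (inner ℝ (pd i φ p) (φ p) : ℝ) = 0 := fun i => by rw [real_inner_comm, h1]
  have h2 := W.inner_pd_N p
  have h2' : ∀ i, (inner ℝ (N p) (pd i φ p) : ℝ) = 0 := fun i => by rw [real_inner_comm, h2]
  have h3 := W.inner_φ_N p
  have h3' : (inner ℝ (N p) (φ p) : ℝ) = 0 := by rw [real_inner_comm, h3]
  have hne : ∀ {v : E4} {r : ℝ}, (inner ℝ v v : ℝ) = r → 0 < r → v ≠ 0 := by
    rintro v r hv hr rfl
    rw [inner_zero_left] at hv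
    exact hr.ne hv
  rw [← sub_eq_zero]
  refine eq_zero_of_inner_eq_zero (b := ![φ p, pd 0 φ p, pd 1 φ p, N p]) ?_ ?_ ?_
  · intro i
    fin_cases i
    · exact hne (W.inner_φ_φ p) one_pos
    · exact hne m00 hE
    · exact hne m11 hQ
    · exact hne (W.inner_N_N p) one_pos
  · intro i j hij
    fin_cases i <;> fin_cases j <;> first | exact absurd rfl hij | simp [*]
  · have e00 := W.inner_φ₀₀_φ₀ p
    have e01 := W.inner_φ₀₀_φ₁ p
    have e10 := W.inner_φ₁₁_φ₀ p
    have e11 := W.inner_φ₁₁_φ₁ p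
    rw [real_inner_comm] at e00 e01 e10 e11 hN0 hN1
    have hφφ := W.inner_φ_φ p
    have hNN := W.inner_N_N p
    intro i
    simp only [tension, covD, Fin.sum_univ_two, diagMetric_inv hE hQ,
      christoffel_diagMetric hE hQ (W.diff_E _) (W.diff_Q _), inner_sub_right, inner_add_right,
      inner_smul_right]
    fin_cases i <;> simp [*, -inner_self_eq_norm_sq_to_K] <;> field_simp <;> ring

lemma tension_fun : tension (diagMetric E Q) φ = fun p => f p.1 • N p := funext W.tension_eq

lemma pd_tension (p : ℝ × ℝ) (i : Fin 2) : pd i (tension (diagMetric E Q) φ) p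
    = f p.1 • pd i N p + pd i (fun q : ℝ × ℝ => f q.1) p • N p := by
  rw [W.tension_fun]
  exact pd_smul ((W.diff_f _).comp p differentiableAt_fst) (W.diff_N p) i

lemma covD_zero_tension (p : ℝ × ℝ) : covD φ 0 (tension (diagMetric E Q) φ) p
    = (f p.1 ^ 2 / 2) • pd 0 φ p + deriv f p.1 • N p := by
  rw [covD, W.pd_tension, pd_zero_comp_fst (W.diff_f _), W.pd_zero_N, inner_add_right,
    inner_smul_right, inner_smul_right, inner_smul_right, W.inner_φ_pd, W.inner_φ_N, smul_smul]
  simp only [mul_zero, add_zero, zero_smul, sub_zero]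
  congr 2; ring

lemma covD_one_tension (p : ℝ × ℝ) : covD φ 1 (tension (diagMetric E Q) φ) p
    = -(3 / 2 * f p.1 ^ 2) • pd 1 φ p := by
  rw [covD, W.pd_tension, pd_one_comp_fst (W.diff_f _), W.pd_one_N, zero_smul, add_zero,
    inner_smul_right, inner_smul_right, W.inner_φ_pd, smul_smul]
  simp only [mul_zero, zero_smul, sub_zero]
  congr 1; ring

/-- In the principal directions, the stress-bienergy tensor has the eigenvalues `-3f²/2` and
`5f²/2`. -/
lemma stressBienergy_eq (i j : Fin 2) : stressBienergy (diagMetric E Q) φ i j = fun p =>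
    !![-(3 / 2) * f p.1 ^ 2 * E p.1, 0; 0, 5 / 2 * f p.1 ^ 2 * Q p.1] i j := by
  funext p
  have hE := W.E_pos p.1
  have hQ := W.Q_pos p.1
  have m00 : (inner ℝ (pd 0 φ p) (pd 0 φ p) : ℝ) = E p.1 := W.metric p 0 0
  have m11 : (inner ℝ (pd 1 φ p) (pd 1 φ p) : ℝ) = Q p.1 := W.metric p 1 1
  have m01 : (inner ℝ (pd 0 φ p) (pd 1 φ p) : ℝ) = 0 := W.metric p 0 1
  have m10 : (inner ℝ (pd 1 φ p) (pd 0 φ p) : ℝ) = 0 := W.metric p 1 0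
  have hnorm : ‖tension (diagMetric E Q) φ p‖ ^ 2 = f p.1 ^ 2 := by
    rw [← real_inner_self_eq_norm_sq, W.tension_eq, inner_smul_left, inner_smul_right,
      W.inner_N_N]
    simp; ring
  have h2 := W.inner_pd_N p
  have hE' := hE.ne'
  have hQ' := hQ.ne'
  simp only [stressBienergy, hnorm, Fin.sum_univ_two, diagMetric_inv hE hQ]
  fin_cases i <;> fin_cases j <;>
    simp [W.covD_zero_tension, W.covD_one_tension, inner_add_right, inner_smul_right, h2, m00, m11,
      m01, m10, diagMetric, -inner_self_eq_norm_sq_to_K] <;> field_simp <;> ring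

/-- The equation `3 f' Q + 2 f Q' = 0`, that is, `f³ Q²` is constant, is the vanishing of the
divergence of the stress-bienergy tensor. -/
lemma isBiconservative (hfQ : ∀ h, 3 * deriv f h * Q h + 2 * f h * deriv Q h = 0) :
    IsBiconservative (diagMetric E Q) φ := by
  have hE := W.diff_E
  have hQ := W.diff_Q
  have hf := W.diff_f
  have hN := W.diff_N
  have d0 : Differentiable ℝ fun h => -(3 / 2) * f h ^ 2 * E h := by fun_prop
  have d1 : Differentiable ℝ fun h => 5 / 2 * f h ^ 2 * Q h := by fun_prop
  refine ⟨?_, fun i j => ?_, fun j p => ?_⟩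
  · rw [W.tension_fun]; fun_prop
  · rw [W.stressBienergy_eq]
    fin_cases i <;> fin_cases j
    · exact d0.comp differentiable_fst
    · exact differentiable_const _
    · exact differentiable_const _
    · exact d1.comp differentiable_fst
  · have hEp := W.E_pos p.1
    have hQp := W.Q_pos p.1
    have pd0 : pd 0 (fun p : ℝ × ℝ => -(3 / 2) * f p.1 ^ 2 * E p.1) p
        = -3 * f p.1 * deriv f p.1 * E p.1 - 3 / 2 * f p.1 ^ 2 * deriv E p.1 := by
      rw [pd_zero_comp_fst (f := fun h => -(3 / 2) * f h ^ 2 * E h) (d0 _)]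
      have := (((hf p.1).hasDerivAt.pow 2).const_mul (-(3 / 2) : ℝ)).mul (hE p.1).hasDerivAt
      refine (HasDerivAt.deriv this).trans ?_
      simp; ring
    have pd1 : pd 1 (fun p : ℝ × ℝ => 5 / 2 * f p.1 ^ 2 * Q p.1) p = 0 :=
      pd_one_comp_fst (f := fun h => 5 / 2 * f h ^ 2 * Q h) (d1 _)
    have hz := fun k => pd_const k (0 : ℝ) p
    have h := hfQ p.1
    simp only [divStressBienergy, W.stressBienergy_eq, Fin.sum_univ_two, diagMetric_inv hEp hQp,
      christoffel_diagMetric hEp hQp (hE _) (hQ _)]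
    fin_cases j
    · simp only [Fin.zero_eta, Matrix.of_apply, Matrix.cons_val_zero, Matrix.cons_val_one,
        Matrix.cons_val_fin_one, pd0, hz]
      field_simp
      linear_combination (-4 * f p.1 * E p.1) * h
    · simp [hz, pd1]

lemma isRiemannianImmersion : IsRiemannianImmersion (diagMetric E Q) φ := by
  refine ⟨W.diff_φ, fun p => ?_, fun p => ?_, W.metric⟩
  · rw [mem_sphere_zero_iff_norm, ← sq_eq_sq₀ (norm_nonneg _) zero_le_one,
      ← real_inner_self_eq_norm_sq, W.inner_φ_φ, one_pow]
  · rw [injective_iff_map_eq_zero]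
    intro v hv
    have hdec : v = v.1 • basisVec 0 + v.2 • basisVec 1 := by
      ext <;> simp [basisVec]
    rw [hdec, map_add, map_smul, map_smul] at hv
    have key : v.1 • pd 0 φ p + v.2 • pd 1 φ p = 0 := hv
    have h0 := congrArg (fun w => (inner ℝ (pd 0 φ p) w : ℝ)) key
    have h1 := congrArg (fun w => (inner ℝ (pd 1 φ p) w : ℝ)) key
    simp only [inner_add_right, inner_smul_right, W.metric, inner_zero_right, diagMetric,
      Matrix.of_apply, Matrix.cons_val_zero, Matrix.cons_val_one, Matrix.cons_val_fin_one,
      mul_zero, add_zero, zero_add, mul_eq_zero, (W.E_pos p.1).ne', (W.Q_pos p.1).ne',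
      or_false] at h0 h1
    exact Prod.ext h0 h1

end IsPrincipalFrame

/-! ### A moving frame of `ℝ⁴` adapted to two rotations -/

/-- The vector of `ℝ⁴ = ℝ² × ℝ²` with coordinates `α, β` in the frame of the first plane rotated
by `ψ`, and `γ, δ` in the frame of the second plane rotated by `χ`. -/
def frameVec (α β γ δ ψ χ : ℝ) : E4 :=
  !₂[α * Real.cos ψ - β * Real.sin ψ, α * Real.sin ψ + β * Real.cos ψ,
     γ * Real.cos χ - δ * Real.sin χ, γ * Real.sin χ + δ * Real.cos χ]

lemma inner_frameVec (α β γ δ α' β' γ' δ' ψ χ : ℝ) :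
    (inner ℝ (frameVec α β γ δ ψ χ) (frameVec α' β' γ' δ' ψ χ) : ℝ)
      = α * α' + β * β' + γ * γ' + δ * δ' := by
  simp only [frameVec, PiLp.inner_apply, Fin.sum_univ_four, RCLike.inner_apply, conj_trivial,
    Matrix.cons_val_zero, Matrix.cons_val_one, Matrix.cons_val]
  linear_combination (α * α' + β * β') * Real.sin_sq_add_cos_sq ψ
    + (γ * γ' + δ * δ') * Real.sin_sq_add_cos_sq χ

lemma smul_frameVec (r α β γ δ ψ χ : ℝ) :
    r • frameVec α β γ δ ψ χ = frameVec (r * α) (r * β) (r * γ) (r * δ) ψ χ := by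
  ext i; fin_cases i <;> simp [frameVec] <;> ring

/-- The section of the trivial `ℝ⁴`-bundle with coordinates `α, β, γ, 0` in the frame rotated by
`ψ(h)` and `kθ`. -/
def frameSection (α β γ ψ : ℝ → ℝ) (k : ℝ) (p : ℝ × ℝ) : E4 :=
  frameVec (α p.1) (β p.1) (γ p.1) 0 (ψ p.1) (k * p.2)

lemma contDiff_frameSection {n : WithTop ℕ∞} {α β γ ψ : ℝ → ℝ} (hα : ContDiff ℝ n α)
    (hβ : ContDiff ℝ n β) (hγ : ContDiff ℝ n γ) (hψ : ContDiff ℝ n ψ) (k : ℝ) :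
    ContDiff ℝ n (frameSection α β γ ψ k) := by
  rw [contDiff_euclidean]
  intro i
  fin_cases i <;> simp [frameSection, frameVec] <;> fun_prop

lemma pd_zero_eq_of_hasDerivAt {f : ℝ × ℝ → ℝ} {p : ℝ × ℝ} {f' : ℝ}
    (hf : DifferentiableAt ℝ f p) (h : HasDerivAt (fun x => f (x, p.2)) f' p.1) :
    pd 0 f p = f' := by
  have hc : HasDerivAt (fun x : ℝ => (x, p.2)) ((1 : ℝ), (0 : ℝ)) p.1 :=
    (hasDerivAt_id _).prodMk (hasDerivAt_const _ _)
  have := HasFDerivAt.comp_hasDerivAt (f := fun x : ℝ => (x, p.2)) p.1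
    (hf.hasFDerivAt : HasFDerivAt f (fderiv ℝ f p) (p.1, p.2)) hc
  exact this.unique h

lemma pd_one_eq_of_hasDerivAt {f : ℝ × ℝ → ℝ} {p : ℝ × ℝ} {f' : ℝ}
    (hf : DifferentiableAt ℝ f p) (h : HasDerivAt (fun x => f (p.1, x)) f' p.2) :
    pd 1 f p = f' := by
  have hc : HasDerivAt (fun x : ℝ => (p.1, x)) ((0 : ℝ), (1 : ℝ)) p.2 :=
    (hasDerivAt_const _ _).prodMk (hasDerivAt_id _)
  have := HasFDerivAt.comp_hasDerivAt (f := fun x : ℝ => (p.1, x)) p.2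
    (hf.hasFDerivAt : HasFDerivAt f (fderiv ℝ f p) (p.1, p.2)) hc
  exact this.unique h

lemma pd_apply {V : ℝ × ℝ → E4} {p : ℝ × ℝ} (hV : DifferentiableAt ℝ V p) (i : Fin 2)
    (j : Fin 4) : pd i V p j = pd i (fun q => V q j) p := by
  have h := (EuclideanSpace.proj (𝕜 := ℝ) j).hasFDerivAt.comp p hV.hasFDerivAt
  have h' : HasFDerivAt (fun q => V q j) _ p := h
  rw [pd, pd, h'.fderiv]; rfl

section FrameDerivatives

variable {α β γ ψ : ℝ → ℝ} {k α' β' γ' ψ' : ℝ} {p : ℝ × ℝ}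

lemma pd_zero_frameSection (hd : DifferentiableAt ℝ (frameSection α β γ ψ k) p)
    (hα : HasDerivAt α α' p.1) (hβ : HasDerivAt β β' p.1) (hγ : HasDerivAt γ γ' p.1)
    (hψ : HasDerivAt ψ ψ' p.1) :
    pd 0 (frameSection α β γ ψ k) p
      = frameVec (α' - β p.1 * ψ') (β' + α p.1 * ψ') γ' 0 (ψ p.1) (k * p.2) := by
  have hcos := hψ.cos
  have hsin := hψ.sin
  have hc := fun j => (differentiableAt_euclidean.1 hd) j
  ext j
  rw [pd_apply hd]
  refine pd_zero_eq_of_hasDerivAt (hc j) ?_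
  fin_cases j
  · convert! (hα.mul hcos).sub (hβ.mul hsin) using 1
    simp [frameVec]; ring
  · convert! (hα.mul hsin).add (hβ.mul hcos) using 1
    simp [frameVec]; ring
  · convert! (hγ.mul_const (Real.cos (k * p.2))).sub
      ((hasDerivAt_const p.1 (0 : ℝ)).mul_const (Real.sin (k * p.2))) using 1
  · convert! (hγ.mul_const (Real.sin (k * p.2))).add
      ((hasDerivAt_const p.1 (0 : ℝ)).mul_const (Real.cos (k * p.2))) using 1

lemma pd_one_frameSection (hd : DifferentiableAt ℝ (frameSection α β γ ψ k) p) :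
    pd 1 (frameSection α β γ ψ k) p = frameVec 0 0 0 (k * γ p.1) (ψ p.1) (k * p.2) := by
  have hlin : HasDerivAt (fun x : ℝ => k * x) k p.2 := by
    simpa using (hasDerivAt_id p.2).const_mul k
  have hc := fun j => (differentiableAt_euclidean.1 hd) j
  ext j
  rw [pd_apply hd]
  refine pd_one_eq_of_hasDerivAt (hc j) ?_
  fin_cases j
  · simpa [frameSection, frameVec] using hasDerivAt_const p.2 _
  · simpa [frameSection, frameVec] using hasDerivAt_const p.2 _
  · convert! (hlin.cos.const_mul (γ p.1)).sub (hlin.sin.const_mul 0) using 1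
    simp [frameVec]; ring
  · convert! (hlin.sin.const_mul (γ p.1)).add (hlin.cos.const_mul 0) using 1
    simp [frameVec]; ring

end FrameDerivatives

/-! ### The profile functions of the height -/

lemma exists_bounds_of_periodic {g : ℝ → ℝ} (hg : Continuous g) (hpos : ∀ x, 0 < g x) {L : ℝ}
    (hL : 0 < L) (hper : Function.Periodic g L) : ∃ m M, 0 < m ∧ ∀ x, m ≤ g x ∧ g x ≤ M := by
  have hc := hper.compact_of_continuous hL.ne' hg
  obtain ⟨m, ⟨x₀, rfl⟩, hm⟩ := hc.exists_isLeast (range_nonempty g)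
  obtain ⟨M, -, hM⟩ := hc.exists_isGreatest (range_nonempty g)
  exact ⟨g x₀, M, hpos x₀, fun x => ⟨hm ⟨x, rfl⟩, hM ⟨x, rfl⟩⟩⟩

namespace Profile

variable (P : Profile)

/-- `F ^ (1 / 3)` as a function of the height. -/
def U (h : ℝ) : ℝ := P.u (P.tau h)

/-- The smooth square root of `T ∘ F` as a function of the height. -/
def S (h : ℝ) : ℝ := P.sig (P.tau h)

/-- The square root of the radicand `3 F² - C*² T(F)` as a function of the height. -/
def d (h : ℝ) : ℝ := √(P.rad (P.tau h))

/-- The square root of `C F² - 1` as a function of the height. -/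
def s (h : ℝ) : ℝ := √(P.C * P.U h ^ 6 - 1)

lemma U_pos (h : ℝ) : 0 < P.U h := P.u_pos _
lemma d_pos (h : ℝ) : 0 < P.d h := Real.sqrt_pos.2 (P.rad_pos _)
lemma s_pos (h : ℝ) : 0 < P.s h := Real.sqrt_pos.2 (P.one_lt _)
lemma s_sq (h : ℝ) : P.s h ^ 2 = P.C * P.U h ^ 6 - 1 := Real.sq_sqrt (P.one_lt _).le
lemma d_sq (h : ℝ) : P.d h ^ 2 = 3 * P.U h ^ 6 - P.Cs ^ 2 * P.S h ^ 2 := by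
  rw [d, Real.sq_sqrt (P.rad_pos _).le, P.rad_eq]; rfl
lemma S_sq (h : ℝ) : P.S h ^ 2 = -P.U h ^ 8 + 3 * P.C * P.U h ^ 6 - 3 := P.sig_sq' _
lemma F_eq_U (h : ℝ) : F P.C P.Cs h = P.U h ^ 3 := P.F_eq h
lemma T_F (h : ℝ) : T P.C (F P.C P.Cs h) = P.S h ^ 2 := by rw [F_eq, T_xi]; rfl

lemma contDiff_U : ContDiff ℝ 4 P.U := P.contDiff_u.comp P.contDiff_tau
lemma contDiff_S : ContDiff ℝ 4 P.S := P.contDiff_sig.comp P.contDiff_tau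
lemma contDiff_d : ContDiff ℝ 4 P.d :=
  (P.contDiff_rad.comp P.contDiff_tau).sqrt fun _ => (P.rad_pos _).ne'
lemma contDiff_s : ContDiff ℝ 4 P.s := by
  have := P.contDiff_U
  exact ContDiff.sqrt (by fun_prop) fun _ => (P.one_lt _).ne'

lemma hasDerivAt_U (h : ℝ) : HasDerivAt P.U (P.S h * P.U h ^ 4 / (3 * P.d h)) h := by
  have h1 := (P.hasDerivAt_u (P.tau h)).comp h (P.hasDerivAt_tau h)
  convert! h1 using 1
  have := P.u_pos (P.tau h)
  have := P.quo_pos (P.tau h)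
  have := P.rad_pos (P.tau h)
  rw [U, S, d, hSpeed, sig]
  field_simp

lemma hasDerivAt_sig (t : ℝ) : HasDerivAt P.sig
    ((-4 * P.y t ^ 3 + 9 * P.C * P.y t ^ 2) / (2 * √(P.quo t))) t := by
  have hy := P.hasDerivAt_y t
  have hq : HasDerivAt P.quo ((2 * P.y t + P.α) * ((P.b - P.a) / 2 * Real.sin t)) t := by
    convert! ((hy.pow 2).add (hy.const_mul P.α)).add_const P.β using 1
    simp; ring
  have h := ((Real.hasDerivAt_sin t).const_mul ((P.b - P.a) / 2)).mul (hq.sqrt (P.quo_pos t).ne')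
  convert! h using 1
  -- differentiate the factorisation of `T` in the variable `y`
  have hpoly : -4 * P.y t ^ 3 + 9 * P.C * P.y t ^ 2
      = (P.a + P.b - 2 * P.y t) * P.quo t
        + (P.y t - P.a) * (P.b - P.y t) * (2 * P.y t + P.α) := by
    have hL : HasDerivAt (fun x : ℝ => -x ^ 4 + 3 * P.C * x ^ 3 - 3)
        (-4 * P.y t ^ 3 + 9 * P.C * P.y t ^ 2) (P.y t) := by
      convert! (((hasDerivAt_id (P.y t)).pow 4).neg.add
        (((hasDerivAt_id (P.y t)).pow 3).const_mul (3 * P.C))).sub_const 3 using 1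
      simp; ring
    have hR : HasDerivAt (fun x : ℝ => (x - P.a) * (P.b - x) * (x ^ 2 + P.α * x + P.β))
        ((P.a + P.b - 2 * P.y t) * P.quo t
          + (P.y t - P.a) * (P.b - P.y t) * (2 * P.y t + P.α)) (P.y t) := by
      convert! (((hasDerivAt_id (P.y t)).sub_const P.a).mul
        ((hasDerivAt_id (P.y t)).const_sub P.b)).mul
        ((((hasDerivAt_id (P.y t)).pow 2).add
          ((hasDerivAt_id (P.y t)).const_mul P.α)).add_const P.β) using 1
      simp only [quo, id, Pi.pow_apply, Pi.add_apply, Pi.mul_apply, Nat.reduceSub]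
      push_cast
      ring
    rw [← funext P.factor] at hR
    exact hL.unique hR
  have hq0 := P.quo_pos t
  have hsq : √(P.quo t) ^ 2 = P.quo t := Real.sq_sqrt hq0.le
  have e1 : P.a + P.b - 2 * P.y t = (P.b - P.a) * Real.cos t := by rw [y]; ring
  have e2 : (P.y t - P.a) * (P.b - P.y t) = ((P.b - P.a) / 2 * Real.sin t) ^ 2 := by
    rw [y, mul_pow, Real.sin_sq]; ring
  rw [hpoly, e1, e2]
  have hs := Real.sqrt_pos.2 hq0
  field_simp
  rw [hsq]
  ring

lemma hasDerivAt_S (h : ℝ) : HasDerivAt P.S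
    ((-4 * P.U h ^ 6 + 9 * P.C * P.U h ^ 4) * P.U h ^ 5 / (3 * P.d h)) h := by
  have h1 := (P.hasDerivAt_sig (P.tau h)).comp h (P.hasDerivAt_tau h)
  convert! h1 using 1
  have := P.u_pos (P.tau h)
  have := P.quo_pos (P.tau h)
  have := P.rad_pos (P.tau h)
  rw [U, d, hSpeed, ← P.u_sq]
  field_simp

lemma hasDerivAt_psi (c₀ h : ℝ) : HasDerivAt (P.psi c₀)
    (√P.C * P.U h ^ 10 / (P.s h ^ 2 * P.d h)) h := by
  have h1 := (((P.hasDerivAt_Z (P.tau h)).comp h (P.hasDerivAt_tau h)).sub_const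
    (P.Z P.baseAngle)).add_const c₀
  convert! h1 using 1
  have := P.u_pos (P.tau h)
  have := P.quo_pos (P.tau h)
  have := P.rad_pos (P.tau h)
  have := P.one_lt (P.tau h)
  rw [P.s_sq, U, d, hSpeed, zSpeed]
  field_simp

lemma hasDerivAt_s (h : ℝ) : HasDerivAt P.s
    (P.C * P.U h ^ 9 * P.S h / (P.s h * P.d h)) h := by
  have h1 := ((((P.hasDerivAt_U h).pow 6).const_mul P.C).sub_const 1).sqrt (P.one_lt _).ne'
  convert! h1 using 1
  have hs := P.s_pos h
  have hd := P.d_pos h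
  change _ = _ / (2 * P.s h)
  field_simp
  norm_num
  ring

/-- The radius of the first circle, `√(1 - 1 / (C F²))`, in the variable `U`. -/
def r1 (h : ℝ) : ℝ := P.s h / (√P.C * P.U h ^ 3)

/-- The radius of the second circle, `1 / (√C F)`, in the variable `U`. -/
def r2 (h : ℝ) : ℝ := 1 / (√P.C * P.U h ^ 3)

/-- The radial component in the first plane of the unit normal. -/
def n1 (h : ℝ) : ℝ := P.U h / (√3 * √P.C * P.s h)

/-- The angular component in the first plane of the unit normal. -/
def n2 (h : ℝ) : ℝ := -P.S h / (√3 * P.s h)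

/-- The radial component in the second plane of the unit normal. -/
def n3 (h : ℝ) : ℝ := -P.U h / (√3 * √P.C)

/-- The trace of the shape operator. -/
def meanCurv (h : ℝ) : ℝ := 2 * P.U h ^ 4 / (3 * √3)

/-- The coefficient of `dh²` in `g_{C,C*}`. -/
def coeffE (h : ℝ) : ℝ :=
  3 * F P.C P.Cs h ^ 2 / (3 * F P.C P.Cs h ^ 2 - P.Cs ^ 2 * T P.C (F P.C P.Cs h))

/-- The coefficient of `dθ²` in `g_{C,C*}`. -/
def coeffQ (h : ℝ) : ℝ := 1 / F P.C P.Cs h ^ 2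

lemma coeffE_eq (h : ℝ) : P.coeffE h = 3 * P.U h ^ 6 / P.d h ^ 2 := by
  rw [coeffE, T_F, F_eq_U, P.d_sq]; ring

lemma coeffQ_eq (h : ℝ) : P.coeffQ h = 1 / P.U h ^ 6 := by
  rw [coeffQ, F_eq_U]; ring

lemma sqrt_C_pos : 0 < √P.C := Real.sqrt_pos.2 P.C_pos
lemma sqrt_C_sq : √P.C ^ 2 = P.C := Real.sq_sqrt P.C_pos.le

lemma contDiff_coeffE : ContDiff ℝ 4 P.coeffE := by
  rw [show P.coeffE = fun h => 3 * P.U h ^ 6 / P.d h ^ 2 from funext P.coeffE_eq]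
  have h1 := P.contDiff_U
  have h2 := P.contDiff_d
  exact ContDiff.div (by fun_prop) (by fun_prop) fun h => (pow_pos (P.d_pos h) 2).ne'

lemma contDiff_coeffQ : ContDiff ℝ 4 P.coeffQ := by
  rw [show P.coeffQ = fun h => 1 / P.U h ^ 6 from funext P.coeffQ_eq]
  have h1 := P.contDiff_U
  exact ContDiff.div (by fun_prop) (by fun_prop) fun h => (pow_pos (P.U_pos h) 6).ne'

lemma coeffE_pos (h : ℝ) : 0 < P.coeffE h := by
  have := P.U_pos h; have := P.d_pos h
  rw [coeffE_eq]; positivity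

lemma coeffQ_pos (h : ℝ) : 0 < P.coeffQ h := by
  have := P.U_pos h
  rw [coeffQ_eq]; positivity

lemma gMetric_eq : gMetric P.C P.Cs = diagMetric P.coeffE P.coeffQ := rfl

lemma isRiemannianMetric : IsRiemannianMetric (gMetric P.C P.Cs) := by
  rw [gMetric_eq]
  have h1 : ContDiff ℝ 3 P.coeffE := P.contDiff_coeffE.of_le (by norm_num)
  have h2 : ContDiff ℝ 3 P.coeffQ := P.contDiff_coeffQ.of_le (by norm_num)
  refine ⟨fun i j => ?_, fun p => ?_⟩
  · fin_cases i <;> fin_cases j <;> simp [diagMetric] <;> fun_prop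
  · have hdiag : diagMetric P.coeffE P.coeffQ p
        = Matrix.diagonal ![P.coeffE p.1, P.coeffQ p.1] := by
      ext i j; fin_cases i <;> fin_cases j <;> rfl
    rw [hdiag, Matrix.posDef_diagonal_iff]
    intro i
    fin_cases i
    · exact P.coeffE_pos _
    · exact P.coeffQ_pos _

lemma isCompleteMetric : IsCompleteMetric (gMetric P.C P.Cs) := by
  have hL : 0 < 2 * (hPos P.C P.Cs - hNeg P.C P.Cs) := by linarith [P.L_pos]
  have hF := P.periodic_F
  have hE : Function.Periodic P.coeffE (2 * (hPos P.C P.Cs - hNeg P.C P.Cs)) := fun h => by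
    unfold coeffE; rw [hF h]
  have hQ : Function.Periodic P.coeffQ (2 * (hPos P.C P.Cs - hNeg P.C P.Cs)) := fun h => by
    unfold coeffQ; rw [hF h]
  obtain ⟨m₁, M₁, hm₁, h₁⟩ :=
    exists_bounds_of_periodic P.contDiff_coeffE.continuous P.coeffE_pos hL hE
  obtain ⟨m₂, M₂, hm₂, h₂⟩ :=
    exists_bounds_of_periodic P.contDiff_coeffQ.continuous P.coeffQ_pos hL hQ
  rw [gMetric_eq]
  exact isCompleteMetric_diagonal (m := min m₁ m₂) (M := max M₁ M₂) (lt_min hm₁ hm₂)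
    (fun h => ⟨(min_le_left _ _).trans (h₁ h).1, (h₁ h).2.trans (le_max_left _ _)⟩)
    (fun h => ⟨(min_le_right _ _).trans (h₂ h).1, (h₂ h).2.trans (le_max_right _ _)⟩)

/-! ### The immersion and its unit normal -/

lemma rho_eq (h : ℝ) : P.rho h = P.r1 h := by
  have hU := P.U_pos h
  have hs := P.s_pos h
  have hk := P.sqrt_C_pos
  have hC := P.C_pos
  have : 1 - 1 / (P.C * F P.C P.Cs h ^ 2) = P.r1 h ^ 2 := by
    rw [F_eq_U, r1, div_pow, mul_pow, P.sqrt_C_sq, P.s_sq]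
    field_simp
  rw [rho, this, Real.sqrt_sq]
  unfold r1; positivity

lemma PhiMap_eq {c : ℤ → ℝ} (hc : IsPhaseSequence P.C c) :
    PhiMap P.C P.Cs c = frameSection P.r1 0 P.r2 (P.psi (c 0)) √P.C := by
  funext p
  rw [PhiMap, P.Phi1_eq hc, P.Phi2_eq hc, P.rho_eq, Phi3, Phi4, F_eq_U]
  simp [frameSection, frameVec, r2]

/-- The unit normal field of the immersion with phase `ψ`. -/
def normal (c₀ : ℝ) : ℝ × ℝ → E4 := frameSection P.n1 P.n2 P.n3 (P.psi c₀) √P.C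

lemma contDiff_r1 : ContDiff ℝ 4 P.r1 := by
  have h1 := P.contDiff_U
  have h2 := P.contDiff_s
  exact ContDiff.div (by fun_prop) (by fun_prop) fun h =>
    (mul_pos P.sqrt_C_pos (pow_pos (P.U_pos h) 3)).ne'

lemma contDiff_r2 : ContDiff ℝ 4 P.r2 := by
  have h1 := P.contDiff_U
  exact ContDiff.div (by fun_prop) (by fun_prop) fun h =>
    (mul_pos P.sqrt_C_pos (pow_pos (P.U_pos h) 3)).ne'

lemma contDiff_immersion (c₀ : ℝ) :
    ContDiff ℝ 4 (frameSection P.r1 0 P.r2 (P.psi c₀) √P.C) :=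
  contDiff_frameSection P.contDiff_r1 contDiff_const P.contDiff_r2 (P.contDiff_psi c₀) _

lemma contDiff_normal (c₀ : ℝ) : ContDiff ℝ 4 (P.normal c₀) := by
  have h1 := P.contDiff_U
  have h2 := P.contDiff_s
  have h3 := P.contDiff_S
  have h3' : (0 : ℝ) < √3 := by positivity
  refine contDiff_frameSection ?_ ?_ ?_ (P.contDiff_psi c₀) _
  · exact ContDiff.div (by fun_prop) (by fun_prop) fun h =>
      (mul_pos (mul_pos h3' P.sqrt_C_pos) (P.s_pos h)).ne'
  · exact ContDiff.div (by fun_prop) (by fun_prop) fun h => (mul_pos h3' (P.s_pos h)).ne'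
  · unfold n3; fun_prop

lemma hasDerivAt_r1 (h : ℝ) : HasDerivAt P.r1 (P.S h / (√P.C * P.s h * P.d h)) h := by
  have hU := P.U_pos h
  have hs := P.s_pos h
  have hd := P.d_pos h
  have hk := P.sqrt_C_pos
  have h1 := (P.hasDerivAt_s h).div (((P.hasDerivAt_U h).pow 3).const_mul √P.C)
    (mul_pos hk (pow_pos hU 3)).ne'
  convert! h1 using 1
  simp only [Pi.pow_apply]
  field_simp
  rw [P.s_sq]
  norm_num
  ring

lemma hasDerivAt_r2 (h : ℝ) : HasDerivAt P.r2 (-P.S h / (√P.C * P.d h)) h := by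
  have hU := P.U_pos h
  have hd := P.d_pos h
  have hk := P.sqrt_C_pos
  have h1 := (hasDerivAt_const h (1 : ℝ)).div (((P.hasDerivAt_U h).pow 3).const_mul √P.C)
    (mul_pos hk (pow_pos hU 3)).ne'
  convert! h1 using 1
  simp only [Pi.pow_apply]
  field_simp
  norm_num
  ring

lemma hasDerivAt_n1 (h : ℝ) : HasDerivAt P.n1
    (-(P.S h * P.U h ^ 4 * (2 * P.s h ^ 2 + 3)) / (3 * √3 * √P.C * P.s h ^ 3 * P.d h)) h := by
  have hs := P.s_pos h
  have hd := P.d_pos h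
  have hk := P.sqrt_C_pos
  have h3 : (0 : ℝ) < √3 := by positivity
  have h1 := (P.hasDerivAt_U h).div ((P.hasDerivAt_s h).const_mul (√3 * √P.C))
    (mul_pos (mul_pos h3 hk) hs).ne'
  convert! h1 using 1
  field_simp
  linear_combination (-3 * P.S h * P.U h ^ 4) * P.s_sq h

lemma hasDerivAt_n2 (h : ℝ) : HasDerivAt P.n2
    (-((-4 * P.U h ^ 6 + 9 * P.C * P.U h ^ 4) * P.U h ^ 5 * P.s h ^ 2
      - 3 * P.C * P.U h ^ 9 * P.S h ^ 2) / (3 * √3 * P.s h ^ 3 * P.d h)) h := by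
  have hs := P.s_pos h
  have hd := P.d_pos h
  have h3 : (0 : ℝ) < √3 := by positivity
  have h1 := (P.hasDerivAt_S h).neg.div ((P.hasDerivAt_s h).const_mul √3) (mul_pos h3 hs).ne'
  convert! h1 using 1
  simp only [Pi.neg_apply]
  field_simp
  ring

lemma hasDerivAt_n3 (h : ℝ) : HasDerivAt P.n3
    (-(P.S h * P.U h ^ 4) / (3 * √3 * √P.C * P.d h)) h := by
  have hd := P.d_pos h
  have hk := P.sqrt_C_pos
  have h3 : (0 : ℝ) < √3 := by positivity
  have h1 := (P.hasDerivAt_U h).neg.div_const (√3 * √P.C)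
  convert! h1 using 1
  field_simp

lemma pd_zero_immersion (c₀ : ℝ) (p : ℝ × ℝ) :
    pd 0 (frameSection P.r1 0 P.r2 (P.psi c₀) √P.C) p
      = frameVec (P.S p.1 / (√P.C * P.s p.1 * P.d p.1)) (P.U p.1 ^ 7 / (P.s p.1 * P.d p.1))
          (-P.S p.1 / (√P.C * P.d p.1)) 0 (P.psi c₀ p.1) (√P.C * p.2) := by
  have hU := P.U_pos p.1
  have hs := P.s_pos p.1
  have hd := P.d_pos p.1
  have hk := P.sqrt_C_pos
  rw [pd_zero_frameSection ((P.contDiff_immersion c₀).differentiable (by norm_num) p)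
    (P.hasDerivAt_r1 _) (hasDerivAt_const _ (0 : ℝ)) (P.hasDerivAt_r2 _) (P.hasDerivAt_psi c₀ _)]
  congr 1
  · simp
  · rw [r1]; field_simp; ring

lemma pd_one_immersion (c₀ : ℝ) (p : ℝ × ℝ) :
    pd 1 (frameSection P.r1 0 P.r2 (P.psi c₀) √P.C) p
      = frameVec 0 0 0 (1 / P.U p.1 ^ 3) (P.psi c₀ p.1) (√P.C * p.2) := by
  have hU := P.U_pos p.1
  have hk := P.sqrt_C_pos
  rw [pd_one_frameSection ((P.contDiff_immersion c₀).differentiable (by norm_num) p)]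
  congr 1
  rw [r2]; field_simp

lemma isPrincipalFrame (c₀ : ℝ) : IsPrincipalFrame P.coeffE P.coeffQ P.meanCurv
    (frameSection P.r1 0 P.r2 (P.psi c₀) √P.C) (P.normal c₀) where
  E_pos := P.coeffE_pos
  Q_pos := P.coeffQ_pos
  diff_E := P.contDiff_coeffE.differentiable (by norm_num)
  diff_Q := P.contDiff_coeffQ.differentiable (by norm_num)
  diff_f := by
    have := P.contDiff_U.differentiable (by norm_num)
    unfold meanCurv; fun_prop
  contDiff_φ := (P.contDiff_immersion c₀).of_le (by norm_num)
  diff_N := (P.contDiff_normal c₀).differentiable (by norm_num)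
  inner_φ_φ p := by
    have hU := P.U_pos p.1
    have hC := P.C_pos
    have hk := P.sqrt_C_pos
    rw [frameSection, inner_frameVec, r1, r2]
    simp only [Pi.zero_apply]
    field_simp
    linear_combination P.s_sq p.1 - P.U p.1 ^ 6 * P.sqrt_C_sq
  metric p i j := by
    have hU := P.U_pos p.1
    have hs := P.s_pos p.1
    have hd := P.d_pos p.1
    have hk := P.sqrt_C_pos
    fin_cases i <;> fin_cases j
    · simp only [Fin.zero_eta, pd_zero_immersion, inner_frameVec]
      change _ = P.coeffE p.1
      rw [P.coeffE_eq]
      field_simp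
      rw [P.sqrt_C_sq]
      linear_combination (P.S p.1 ^ 2 - 3 * P.C * P.U p.1 ^ 6) * P.s_sq p.1
        + P.C * P.U p.1 ^ 6 * P.S_sq p.1
    · simp only [Fin.zero_eta, Fin.mk_one, pd_zero_immersion, pd_one_immersion, inner_frameVec]
      change _ = (0 : ℝ)
      simp
    · simp only [Fin.zero_eta, Fin.mk_one, pd_zero_immersion, pd_one_immersion, inner_frameVec]
      change _ = (0 : ℝ)
      simp
    · simp only [Fin.mk_one, pd_one_immersion, inner_frameVec]
      change _ = P.coeffQ p.1
      rw [P.coeffQ_eq]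
      field_simp
      ring
  inner_N_N p := by
    have hs := P.s_pos p.1
    have hC := P.C_pos
    have h3 : √3 ^ 2 = (3 : ℝ) := Real.sq_sqrt (by norm_num)
    rw [normal, frameSection, inner_frameVec, ← sq, ← sq, ← sq, n1, n2, n3, div_pow, div_pow,
      div_pow, mul_pow, mul_pow, mul_pow, P.sqrt_C_sq, h3]
    field_simp
    linear_combination (P.U p.1 ^ 2 - 3 * P.C) * P.s_sq p.1 + P.C * P.S_sq p.1
  inner_φ_N p := by
    have hU := P.U_pos p.1
    have hs := P.s_pos p.1
    have hk := P.sqrt_C_pos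
    rw [normal, frameSection, frameSection, inner_frameVec, r1, r2, n1, n3]
    simp only [Pi.zero_apply]
    field_simp
    ring
  inner_pd_N p i := by
    have hU := P.U_pos p.1
    have hs := P.s_pos p.1
    have hd := P.d_pos p.1
    have hk := P.sqrt_C_pos
    have hC := P.C_pos
    fin_cases i
    · simp only [Fin.zero_eta, pd_zero_immersion]
      rw [normal, frameSection, inner_frameVec, n1, n2, n3]
      field_simp
      rw [P.sqrt_C_sq]
      linear_combination (P.S p.1 * P.U p.1) * P.s_sq p.1
    · simp only [Fin.mk_one, pd_one_immersion]
      rw [normal, frameSection, inner_frameVec]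
      simp
  pd_zero_N p := by
    have hU := P.U_pos p.1
    have hs := P.s_pos p.1
    have hd := P.d_pos p.1
    have hk := P.sqrt_C_pos
    have hC := P.C_pos
    rw [normal, pd_zero_frameSection ((P.contDiff_normal c₀).differentiable (by norm_num) p)
      (P.hasDerivAt_n1 _) (P.hasDerivAt_n2 _) (P.hasDerivAt_n3 _) (P.hasDerivAt_psi c₀ _),
      P.pd_zero_immersion, smul_frameVec, meanCurv]
    congr 1
    · rw [n2]
      field_simp
      rw [P.sqrt_C_sq]
      linear_combination (-3 * P.S p.1) * P.s_sq p.1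
    · rw [n1]
      field_simp
      linear_combination (3 * P.U p.1 ^ 2 - 9 * P.C) * P.s_sq p.1 + 3 * P.C * P.S_sq p.1
    · field_simp
    · simp
  pd_one_N p := by
    have hU := P.U_pos p.1
    have hk := P.sqrt_C_pos
    rw [normal, pd_one_frameSection ((P.contDiff_normal c₀).differentiable (by norm_num) p),
      P.pd_one_immersion, smul_frameVec, meanCurv, n3]
    congr 1
    · simp
    · simp
    · simp
    · field_simp

/-- The differential form of the constancy of `f³ Q²`, which holds because `f` is a multiple of
`F ^ (4 / 3)` and `Q = F⁻²`. -/
lemma meanCurv_ode (h : ℝ) :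
    3 * deriv P.meanCurv h * P.coeffQ h + 2 * P.meanCurv h * deriv P.coeffQ h = 0 := by
  have hU := P.U_pos h
  have hd := P.d_pos h
  have h1 : HasDerivAt P.meanCurv _ h :=
    (((P.hasDerivAt_U h).pow 4).const_mul 2).div_const (3 * √3)
  have h2 : HasDerivAt (fun h => 1 / P.U h ^ 6) _ h :=
    (hasDerivAt_const h (1 : ℝ)).div ((P.hasDerivAt_U h).pow 6) (pow_pos hU 6).ne'
  rw [show P.coeffQ = fun h => 1 / P.U h ^ 6 from funext P.coeffQ_eq, h1.deriv, h2.deriv, meanCurv]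
  field_simp
  norm_num
  ring

end Profile

end

end Biconservative

theorem theorem4p10 (C Cs : ℝ) (hC : 4 / (3 : ℝ) ^ (3 / 2 : ℝ) < C) (hCs_pos : 0 < Cs)
    (hCs_lt : Cs < (C - 4 / (3 : ℝ) ^ (3 / 2 : ℝ)) ^ (-(1 / 2) : ℝ))
    (c : ℤ → ℝ) (hc : IsPhaseSequence C c) :
    -- the ingredients are well defined, and `F` is the periodic `C³` function glued from the
    -- inverses of the `h_k`
    IsWellDefined C Cs ∧
    (∀ k : ℤ, ∀ ξ ∈ Set.Icc (xi01 C) (xi02 C), F C Cs (hk C Cs k ξ) = ξ) ∧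
    ContDiff ℝ 3 (F C Cs) ∧
    Function.Periodic (F C Cs) (2 * (hPos C Cs - hNeg C Cs)) ∧
    -- `(ℝ², g_{C,C*})` is a complete Riemannian surface
    IsRiemannianMetric (gMetric C Cs) ∧
    IsCompleteMetric (gMetric C Cs) ∧
    -- `Φ¹`, `Φ²` are given by the prescribed formulas on all closed pieces, so that
    -- `Φ_{C,C*}(h, θ) = Φ_C(F(h), θ)` there
    (∀ k : ℤ, ∀ h ∈ piece C Cs k,
      Phi1 C Cs c h = Phi1k C c k (F C Cs h) ∧ Phi2 C Cs c h = Phi2k C c k (F C Cs h) ∧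
      ∀ θ : ℝ, PhiMap C Cs c (h, θ) = PhiLocal C ((-1) ^ k) (c k) (F C Cs h) θ) ∧
    -- `Φ_{C,C*}` is a biconservative immersion into `𝕊³`
    ContDiff ℝ 3 (PhiMap C Cs c) ∧
    IsRiemannianImmersion (gMetric C Cs) (PhiMap C Cs c) ∧
    IsBiconservative (gMetric C Cs) (PhiMap C Cs c) := by
  obtain ⟨P, rfl, rfl⟩ := exists_profile hC hCs_pos hCs_lt
  have W := P.isPrincipalFrame (c 0)
  refine ⟨P.isWellDefined, fun k ξ hξ => P.F_hk k hξ, P.contDiff_F, P.periodic_F,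
    P.isRiemannianMetric, P.isCompleteMetric, fun k h hh => ⟨?_, ?_, P.PhiMap_eq_PhiLocal hc hh⟩,
    ?_, ?_, ?_⟩
  · rw [P.Phi1_eq hc, P.Phi1k_eq hc hh]
  · rw [P.Phi2_eq hc, P.Phi2k_eq hc hh]
  · rw [P.PhiMap_eq hc]
    exact (P.contDiff_immersion (c 0)).of_le (by norm_num)
  · rw [P.PhiMap_eq hc, P.gMetric_eq]
    exact W.isRiemannianImmersion
  · rw [P.PhiMap_eq hc, P.gMetric_eq]
    exact W.isBiconservative P.meanCurv_ode
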